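/- **Setting.** All manifolds and maps are $C^\infty$. Let $\pi:E\to M$ and $\pi':E'\to M'$ be smooth fiber bundles with $\dim M=\dim M'=n$, $\dim E=n+m$, $\dim E'=n+m'$. Let $J^\infty(\pi)$ be the inverse limit of the jet spaces $J^k(\pi)$ of local sections of $\pi$, with canonical coordinates $(x_i,u^j_\sigma)$, and let $\mathcal F(\pi)$ be the algebra of functions on $J^\infty(\pi)$ that are pulled back from a smooth function on some $J^k(\pi)$. Let $\mathcal C(\pi)$ be the Cartan distribution on $J^\infty(\pi)$: its plane at $\theta$ is spanned by the total derivatives $D_i|_\theta$, $D_i=\partial_{x_i}+\sum_{j,\rho}u^j_{\rho+1_i}\partial_{u^j_\rho}$, i.e. it is the tangent plane to the graphs of infinite prolongations $\mathfrak s^{(\infty)}$ of local sections. Similarly for $\pi'$, with coordinates $(x'_i,u'^j_\sigma)$. A $\mathcal C$-morphism is a map $\mathcal B:J^\infty(\pi)\to J^\infty(\pi')$ that is smooth ($\mathcal B^*\mathcal F(\pi')\subseteq\mathcal F(\pi)$) and satisfies $\mathcal B_*\mathcal C_\theta(\pi)\subseteq\mathcal C_{\mathcal B(\theta)}(\pi')$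 for all $\theta\in J^\infty(\pi)$; put $\xi^i=x'_i\circ\mathcal B$. It is called regular at $\theta$ if $\det(D_s\xi^i)\neq0$ at $\theta$. An integral manifold of $\mathcal C(\pi)$ is a smooth immersion $\iota:N\to J^\infty(\pi)$ of a finite-dimensional manifold $N$ (not necessarily injective) with $\iota_*T_pN\subseteq\mathcal C_{\iota(p)}(\pi)$ for all $p\in N$; it satisfies the independence condition $dx_1\wedge\dots\wedge dx_n\neq0$ if $\iota^*(dx_1\wedge\dots\wedge dx_n)$ vanishes at no point of $N$. **Proposition.** Let $\mathcal B:J^\infty(\pi)\to J^\infty(\pi')$ be a $\mathcal C$-morphism. 1. Let $\iota:N\to J^\infty(\pi)$ be an integral manifold of $\mathcal C(\pi)$ satisfying $dx_1\wedge\dots\wedge dx_n\neq0$, and suppose that $\det(D_s\xi^i)\neq0$ at $\iota(p)$ for every $p\in N$. Then $\mathcal B\circ\iota$ is an integral manifold of $\mathcal C(\pi')$ satisfying $dx'_1\wedge\dots\wedge dx'_n\neq0$. Moreover every $p\in N$ has an open neighbourhood $U$ for which there is a local section $\mathfrak s'$ of $\pi'$ such that $\pi'_\infty\circ\mathcal B\circ\iota$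 maps $U$ bijectively onto the domain of $\mathfrak s'$ and $\mathcal B(\iota(q))=\mathfrak s'^{(\infty)}(x')$, $x'=\pi'_\infty(\mathcal B(\iota(q)))$, for all $q\in U$. 2. Consequently $\mathcal B$ maps infinite prolongations of local sections locally to infinite prolongations of local sections: if $\mathfrak s$ is a local section of $\pi$, $a$ is a point of its domain, and $\det(D_s\xi^i)\neq0$ at $\mathfrak s^{(\infty)}(a)$, then there are an open neighbourhood $U$ of $a$ in the domain of $\mathfrak s$ and a local section $\mathfrak s'$ of $\pi'$ such that $\pi'_\infty\circ\mathcal B\circ\mathfrak s^{(\infty)}$ maps $U$ bijectively onto the domain of $\mathfrak s'$ and $\mathcal B(\mathfrak s^{(\infty)}(x))=\mathfrak s'^{(\infty)}(x')$, $x'=\pi'_\infty(\mathcal B(\mathfrak s^{(\infty)}(x)))$, for all $x\in U$. -/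

import Mathlib

open scoped Manifold ContDiff Topology

noncomputable section

namespace JetGeom

/-- The Euclidean model space `ℝⁿ`. -/
abbrev Euc (n : ℕ) : Type := EuclideanSpace ℝ (Fin n)

/-! ### Multi-indices and partial derivatives -/

/-- `∂f/∂xᵢ` for a vector-valued function on `ℝⁿ`. -/
def pderiv {n m : ℕ} (i : Fin n) (f : Euc n → Euc m) : Euc n → Euc m :=
  fun x => fderiv ℝ f x (EuclideanSpace.single i (1 : ℝ))

/-- `∂^|σ| f / ∂x₁^σ₁ … ∂xₙ^σₙ` for a multi-index `σ`. -/
def mpderiv {n m : ℕ} (σ : Fin n → ℕ) (f : Euc n → Euc m) : Euc n → Euc m :=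
  (List.finRange n).foldr (fun i g => (pderiv i)^[σ i] g) f

/-- Multi-indices `σ` of order `|σ| ≤ k`. -/
def MultiIndex (n k : ℕ) : Type := {σ : Fin n → ℕ // ∑ i, σ i ≤ k}

instance (n k : ℕ) : Finite (MultiIndex n k) := by
  refine Finite.of_injective (β := Fin n → Fin (k + 1))
    (fun σ i => ⟨σ.1 i, Nat.lt_succ_of_le
      ((Finset.single_le_sum (f := σ.1) (fun _ _ => Nat.zero_le _) (Finset.mem_univ i)).trans
        σ.2)⟩) ?_
  intro σ τ h
  apply Subtype.ext
  funext i
  exact congrArg Fin.val (congrFun h i)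

instance (n k : ℕ) : Fintype (MultiIndex n k) := Fintype.ofFinite _

/-- The space of values of the canonical coordinates `(xᵢ, u^j_σ)`, `|σ| ≤ k`, of `k`-jets. -/
abbrev JetCoord (n m k : ℕ) : Type := Euc n × (MultiIndex n k → Euc m)

/-! ### Fiber bundles, fibred charts, local sections -/

section Bundle

variable (n m : ℕ)
  {M : Type*} [TopologicalSpace M] [ChartedSpace (Euc n) M]
  {E : Type*} [TopologicalSpace E] [ChartedSpace (Euc (n + m)) E]

/-- `π : E → M` is a smooth fiber bundle with typical fiber the `m`-dimensional manifold `F`: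
it is locally trivial, with local trivializations that are diffeomorphisms. -/
def IsSmoothFiberBundle (F : Type*) [TopologicalSpace F] [ChartedSpace (Euc m) F]
    (π : E → M) : Prop :=
  ∀ a : M, ∃ e : Bundle.Trivialization F π, a ∈ e.baseSet ∧
    ContMDiffOn (𝓡 (n + m)) ((𝓡 n).prod (𝓡 m)) ∞ e.toOpenPartialHomeomorph e.source ∧
    ContMDiffOn ((𝓡 n).prod (𝓡 m)) (𝓡 (n + m)) ∞ e.toOpenPartialHomeomorph.symm e.target

/-- A fibred chart of `π : E → M`: smooth local coordinates `x` on `M` together with smooth local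
coordinates `(x, u)` on `E`, in which `π` is the projection `(x, u) ↦ x`. -/
structure FibredChart (π : E → M) where
  base : OpenPartialHomeomorph M (Euc n)
  total : OpenPartialHomeomorph E (Euc n × Euc m)
  base_mem : base ∈ IsManifold.maximalAtlas (𝓡 n) ∞ M
  smooth_total : ContMDiffOn (𝓡 (n + m)) 𝓘(ℝ, Euc n × Euc m) ∞ total total.source
  smooth_symm : ContMDiffOn 𝓘(ℝ, Euc n × Euc m) (𝓡 (n + m)) ∞ total.symm total.target
  proj_mem : ∀ e ∈ total.source, π e ∈ base.source
  fst_eq : ∀ e ∈ total.source, (total e).1 = base (π e)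

/-- A smooth local section of `π : E → M`, over the open set `dom`
(the values of `toFun` outside `dom` are irrelevant). -/
structure LocalSection (π : E → M) where
  dom : TopologicalSpace.Opens M
  toFun : M → E
  smooth : ContMDiffOn (𝓡 n) (𝓡 (n + m)) ∞ toFun (dom : Set M)
  isSection : ∀ x ∈ dom, π (toFun x) = x

variable {n m} {π : E → M}

/-- The local representative `x ↦ u(x)` of a section in a fibred chart. -/
def FibredChart.rep (c : FibredChart n m π) (s : LocalSection n m π) : Euc n → Euc m :=
  fun x => (c.total (s.toFun (c.base.symm x))).2

/-! ### Finite order jets -/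

variable (n m π) in
/-- A local section together with a point of its domain. -/
structure PointedSection where
  pt : M
  sec : LocalSection n m π
  mem : pt ∈ sec.dom

variable (n m π) in
/-- Two local sections have the same `k`-jet at a point `a` when they have the same value at `a`
and, in fibred charts around this value, the same partial derivatives up to order `k` at `a`. -/
def jetSetoid (k : ℕ) : Setoid (PointedSection n m π) where
  r p q := p.pt = q.pt ∧ p.sec.toFun p.pt = q.sec.toFun q.pt ∧
    ∀ c : FibredChart n m π, p.sec.toFun p.pt ∈ c.total.source →
      ∀ σ : Fin n → ℕ, ∑ i, σ i ≤ k →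
        mpderiv σ (c.rep p.sec) (c.base p.pt) = mpderiv σ (c.rep q.sec) (c.base q.pt)
  iseqv :=
    { refl := fun _ => ⟨rfl, rfl, fun _ _ _ _ => rfl⟩
      symm := fun h => ⟨h.1.symm, h.2.1.symm,
        fun c hc σ hσ => (h.2.2 c (h.2.1 ▸ hc) σ hσ).symm⟩
      trans := fun h₁ h₂ => ⟨h₁.1.trans h₂.1, h₁.2.1.trans h₂.2.1,
        fun c hc σ hσ => (h₁.2.2 c hc σ hσ).trans (h₂.2.2 c (h₁.2.1 ▸ hc) σ hσ)⟩ }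

variable (n m π) in
/-- The `k`-th order jet space `J^k(π)`. -/
def Jet (k : ℕ) : Type _ := Quotient (jetSetoid n m π k)

/-- The natural projection `π_{h,k} : J^h(π) → J^k(π)`, for `k ≤ h`. -/
def Jet.proj {h k : ℕ} (hk : k ≤ h) : Jet n m π h → Jet n m π k :=
  Quotient.map' id (fun _ _ H => ⟨H.1, H.2.1, fun c hc σ hσ => H.2.2 c hc σ (hσ.trans hk)⟩)

/-- The projection `π_k : J^k(π) → M`. -/
def Jet.base {k : ℕ} : Jet n m π k → M :=
  Quotient.lift (fun p => p.pt) (fun _ _ H => H.1)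

/-- The projection `π_{k,0} : J^k(π) → E`. -/
def Jet.target {k : ℕ} : Jet n m π k → E :=
  Quotient.lift (fun p => p.sec.toFun p.pt) (fun _ _ H => H.2.1)

/-- The `k`-jet `[s]_a^k`. -/
def LocalSection.jet (s : LocalSection n m π) (k : ℕ) (a : M) (ha : a ∈ s.dom) : Jet n m π k :=
  Quotient.mk (jetSetoid n m π k) ⟨a, s, ha⟩

/-- The canonical coordinates `(xᵢ, u^j_σ)` on `J^k(π)` induced by a fibred chart. They are
computed on a representative; over the domain of the chart the choice is irrelevant. -/
def FibredChart.jetCoord (c : FibredChart n m π) {k : ℕ} (θ : Jet n m π k) : JetCoord n m k :=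
  let p : PointedSection n m π := Quotient.out θ
  (c.base p.pt, fun σ => mpderiv σ.1 (c.rep p.sec) (c.base p.pt))

/-- `g ∈ 𝓕_k(π)`: the function `g : J^k(π) → ℝ` is smooth, i.e. around every point it is a smooth
function of the canonical coordinates of some fibred chart. -/
def IsSmoothOnJet (k : ℕ) (g : Jet n m π k → ℝ) : Prop :=
  ∀ θ : Jet n m π k, ∃ c : FibredChart n m π, θ.target ∈ c.total.source ∧
    ∃ (G : JetCoord n m k → ℝ) (O : Set (JetCoord n m k)),
      IsOpen O ∧ c.jetCoord θ ∈ O ∧ ContDiffOn ℝ ∞ G O ∧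
      ∀ η : Jet n m π k, η.target ∈ c.total.source → c.jetCoord η ∈ O → g η = G (c.jetCoord η)

/-! ### The infinite jet space -/

variable (n m π) in
/-- The infinite jet space `J^∞(π)`: the inverse limit of the spaces `J^k(π)`. -/
def JetInf : Type _ :=
  {θ : ∀ k : ℕ, Jet n m π k // ∀ (h k : ℕ) (hk : k ≤ h), Jet.proj hk (θ h) = θ k}

/-- The projection `π_∞ : J^∞(π) → M`. -/
def JetInf.base (θ : JetInf n m π) : M := (θ.1 0).base

/-- The infinite prolongation `s^(∞) : dom s → J^∞(π)` of a local section. -/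
def LocalSection.prolong (s : LocalSection n m π) (x : s.dom) : JetInf n m π :=
  ⟨fun k => s.jet k x.1 x.2, fun _ _ _ => rfl⟩

variable (n m π) in
/-- The smooth functions `𝓕(π)` on `J^∞(π)`: those that come from a smooth function on some
`J^k(π)`. -/
def SmoothFun : Type _ :=
  {f : JetInf n m π → ℝ //
    ∃ (k : ℕ) (g : Jet n m π k → ℝ), IsSmoothOnJet k g ∧ ∀ θ, f θ = g (θ.1 k)}

/-- The function `f ∘ s^(∞)` on the domain of `s`, extended by zero to `M`. -/
def LocalSection.pullback (s : LocalSection n m π) (f : JetInf n m π → ℝ) : M → ℝ :=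
  open Classical in fun x => if h : x ∈ s.dom then f (s.prolong ⟨x, h⟩) else 0

/-! ### Total derivatives and the Cartan distribution -/

/-- `c` is the total derivative at `θ`, along the tangent vector `w` of `M` at `π_∞(θ)`, of the
function `f`: it is the derivative along `w` of `f ∘ s^(∞)` for each local section `s` whose jet of
some sufficiently high order `K` is the one of `θ` (`K = k + 1` works if `f` has order `k` near
`θ`). By the chain rule, for a function of finite order and `w = ∂/∂xᵢ` this is
`∂f/∂xᵢ + ∑ u^j_{σ+1ᵢ} ∂f/∂u^j_σ` at `θ`. -/
def HasTotalDeriv (f : JetInf n m π → ℝ) (θ : JetInf n m π) (w : TangentSpace (𝓡 n) θ.base)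
    (c : ℝ) : Prop :=
  ∃ K : ℕ, ∀ (s : LocalSection n m π) (h : θ.base ∈ s.dom), s.jet K θ.base h = θ.1 K →
    MDifferentiableAt (𝓡 n) 𝓘(ℝ, ℝ) (s.pullback f) θ.base ∧
      mfderiv (𝓡 n) 𝓘(ℝ, ℝ) (s.pullback f) θ.base w = c

/-- The total derivative `Dᵢ f` at `θ`, with respect to the preferred coordinates `x₁, …, xₙ` of
`M` around `π_∞(θ)`. -/
def totalDeriv (i : Fin n) (f : JetInf n m π → ℝ) (θ : JetInf n m π) : ℝ :=
  open Classical in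
  if h : ∃ c, HasTotalDeriv f θ (EuclideanSpace.single i (1 : ℝ) : Euc n) c then h.choose else 0

/-- The Cartan distribution `𝓒(π)`: its plane at `θ` is spanned by the tangent vectors
`Dᵢ|_θ : 𝓕(π) → ℝ`, i.e. it is the tangent plane at `θ` to the graphs of prolonged sections. -/
def cartan (θ : JetInf n m π) : Submodule ℝ (SmoothFun n m π → ℝ) :=
  Submodule.span ℝ (Set.range fun i : Fin n => fun f : SmoothFun n m π => totalDeriv i f.1 θ)

end Bundle

/-! ### `𝓒`-morphisms -/

section Morphism

variable {n m m' : ℕ}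
  {M : Type*} [TopologicalSpace M] [ChartedSpace (Euc n) M]
  {E : Type*} [TopologicalSpace E] [ChartedSpace (Euc (n + m)) E] {π : E → M}
  {M' : Type*} [TopologicalSpace M'] [ChartedSpace (Euc n) M']
  {E' : Type*} [TopologicalSpace E'] [ChartedSpace (Euc (n + m')) E'] {π' : E' → M'}

/-- `B : J^∞(π) → J^∞(π')` is smooth: `B^* 𝓕(π') ⊆ 𝓕(π)`. -/
def IsSmoothMap (B : JetInf n m π → JetInf n m' π') : Prop :=
  ∀ f : SmoothFun n m' π', ∃ g : SmoothFun n m π, ∀ θ, g.1 θ = f.1 (B θ)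

/-- The pull-back `B^* : 𝓕(π') → 𝓕(π)` of a smooth map. -/
def IsSmoothMap.pullback {B : JetInf n m π → JetInf n m' π'} (hB : IsSmoothMap B)
    (f : SmoothFun n m' π') : SmoothFun n m π :=
  ⟨fun θ => f.1 (B θ), by
    obtain ⟨g, hg⟩ := hB f
    obtain ⟨k, g', hg', H⟩ := g.2
    exact ⟨k, g', hg', fun θ => (hg θ).symm.trans (H θ)⟩⟩

/-- A `𝓒`-morphism: a smooth map `B` whose push-forward `B_* v = v ∘ B^*` maps the Cartan plane
at each `θ` into the Cartan plane at `B θ`. -/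
def IsCMorphism (B : JetInf n m π → JetInf n m' π') : Prop :=
  ∃ hB : IsSmoothMap B, ∀ θ, ∀ v ∈ cartan θ, (fun f => v (hB.pullback f)) ∈ cartan (B θ)

/-- The component `ξ^i = x'ᵢ ∘ B` of `B`, where `x'` are the preferred coordinates of `M'` around
the point `a'`. -/
def xiComponent (B : JetInf n m π → JetInf n m' π') (a' : M') (i : Fin n) :
    JetInf n m π → ℝ :=
  fun η => (chartAt (Euc n) a' (B η).base) i

/-- The regularity assumption `det (D_s ξ^i) ≠ 0` at `θ`. -/
def IsRegularAt (B : JetInf n m π → JetInf n m' π') (θ : JetInf n m π) : Prop :=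
  (Matrix.of fun s i : Fin n => totalDeriv s (xiComponent B (B θ).base i) θ).det ≠ 0

/-! ### Integral manifolds -/

variable {d : ℕ} {N : Type*} [TopologicalSpace N] [ChartedSpace (Euc d) N]

/-- The push-forward `ι_* X : 𝓕(π) → ℝ` of a tangent vector `X` of `N` at `p`. -/
def pushTangent (ι : N → JetInf n m π) (p : N) (X : TangentSpace (𝓡 d) p) :
    SmoothFun n m π → ℝ :=
  fun f => mfderiv (𝓡 d) 𝓘(ℝ, ℝ) (fun q => f.1 (ι q)) p X

variable (d) in
/-- The map `ι`, from a `d`-dimensional manifold `N` to `J^∞(π)`, is an (immersed) integral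
manifold of the Cartan distribution: it is smooth, an immersion, and `ι_* T_p N` is contained in
the Cartan plane at `ι p`, for each `p`. -/
def IsIntegralManifold (ι : N → JetInf n m π) : Prop :=
  (∀ f : SmoothFun n m π, ContMDiff (𝓡 d) 𝓘(ℝ, ℝ) ∞ (fun q => f.1 (ι q))) ∧
  (∀ (p : N) (X : TangentSpace (𝓡 d) p), pushTangent ι p X = 0 → X = 0) ∧
  (∀ (p : N) (X : TangentSpace (𝓡 d) p), pushTangent ι p X ∈ cartan (ι p))

variable (d) in
/-- The independence condition `dx₁ ∧ … ∧ dxₙ ≠ 0`: at each `p`, the pull-back of this form by `ι`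
takes a nonzero value `det (dxᵢ(v_j))` on some tangent vectors `v₁, …, vₙ` of `N`. Here `x` are
the preferred coordinates of `M` around `π_∞(ι p)`. -/
def IndependenceCondition (ι : N → JetInf n m π) : Prop :=
  ∀ p : N, ∃ v : Fin n → TangentSpace (𝓡 d) p,
    (Matrix.of fun i j : Fin n =>
      (mfderiv (𝓡 d) 𝓘(ℝ, ℝ)
        (fun q => (chartAt (Euc n) (ι p).base (ι q).base) i) p (v j) : ℝ)).det ≠ 0

/-- Near `p`, the map `ι : N → J^∞(π)` is, up to a bijective reparametrization `π_∞ ∘ ι`, the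
infinite prolongation of a local section of `π`. -/
def IsProlongationNear {N : Type*} [TopologicalSpace N] (ι : N → JetInf n m π) (p : N) : Prop :=
  ∃ U : Set N, IsOpen U ∧ p ∈ U ∧ ∃ s : LocalSection n m π,
    Set.BijOn (fun q => (ι q).base) U (s.dom : Set M) ∧
    ∀ q ∈ U, ∀ h : (ι q).base ∈ s.dom, ι q = s.prolong ⟨(ι q).base, h⟩

end Morphism

end JetGeom

end

open JetGeom

/-! A Cartan vector at `θ` is a total derivative `D_w` along a unique tangent vector `w` of the
base, and `w` is read off by testing on functions pulled back from the base (`mem_cartan_iff`,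
`tangent_ext`). So along an integral manifold `ι` every derivative of `f ∘ ι` in a direction `X`
equals `D_w f` with `w = d(π_∞ ∘ ι) X` (`mfderiv_eq_jetDeriv_of_mem_cartan`): the projection to the
base controls everything.

A `𝓒`-morphism `B` sends `D_w` to some `D_{w'}`, and testing on the coordinates `x'ᵢ` gives `w'ᵢ =
∑ₛ wₛ Dₛξⁱ` (`coord_push_eq`). Regularity makes `w ↦ w'` injective, so `B ∘ ι` is again an
immersion, and the Jacobian of `x' ∘ B ∘ ι` is the product of the transpose of `(Dₛξⁱ)` with the
Jacobian of `x ∘ ι`; hence the independence condition survives (`IsIntegralManifold.comp`).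

It remains to see that an integral manifold whose projection to the base has bijective differential
is locally a prolongation (`isProlongationNear_of_bijective`). The inverse function theorem
reparametrizes it by the base as a family of jets `h x` over `x`. Tangency to the Cartan planes says
`∂ᵢ (u_σ ∘ h) = u_{σ+1ᵢ} ∘ h`, so induction on `|σ|` identifies `u_σ ∘ h` with the derivatives of
the section `π_{∞,0} ∘ h` (`exists_prolong_eq`). For a prolonged section the same argument applies
directly, bijectivity coming from regularity.

Two technical points recur. Elements of `𝓕(π)` are global functions, so local coordinates enter only
after multiplication by bump functions. And `J^∞(π)` carries no topology here, so every notion of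
nearness is tested along maps from finite-dimensional manifolds. -/

namespace JetGeom

/-! ### Iterated partial derivatives -/

section Calculus

variable {n m : ℕ} {O : Set (Euc n)} {f g : Euc n → Euc m}

theorem contDiffOn_fderiv_of_isOpen {V W : Type*} [NormedAddCommGroup V] [NormedSpace ℝ V]
    [NormedAddCommGroup W] [NormedSpace ℝ W] {f : V → W} {O : Set V} (hO : IsOpen O)
    (hf : ContDiffOn ℝ ∞ f O) : ContDiffOn ℝ ∞ (fderiv ℝ f) O :=
  hf.fderiv_of_isOpen hO (by simp)

theorem pderiv_contDiffOn (hO : IsOpen O) (hf : ContDiffOn ℝ ∞ f O) (i : Fin n) :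
    ContDiffOn ℝ ∞ (pderiv i f) O :=
  (contDiffOn_fderiv_of_isOpen hO hf).clm_apply contDiffOn_const

theorem pderiv_eqOn (hO : IsOpen O) (h : Set.EqOn f g O) (i : Fin n) :
    Set.EqOn (pderiv i f) (pderiv i g) O := fun x hx => by
  unfold pderiv
  rw [Filter.EventuallyEq.fderiv_eq (h.eventuallyEq_of_mem (hO.mem_nhds hx))]

theorem iterate_pderiv_contDiffOn (hO : IsOpen O) (hf : ContDiffOn ℝ ∞ f O) (i : Fin n) (k : ℕ) :
    ContDiffOn ℝ ∞ ((pderiv i)^[k] f) O := by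
  induction k with
  | zero => exact hf
  | succ k ih => rw [Function.iterate_succ_apply']; exact pderiv_contDiffOn hO ih i

theorem iterate_pderiv_eqOn (hO : IsOpen O) (h : Set.EqOn f g O) (i : Fin n) (k : ℕ) :
    Set.EqOn ((pderiv i)^[k] f) ((pderiv i)^[k] g) O := by
  induction k with
  | zero => exact h
  | succ k ih =>
    rw [Function.iterate_succ_apply', Function.iterate_succ_apply']
    exact pderiv_eqOn hO ih i

theorem pderiv_comm (hO : IsOpen O) (hf : ContDiffOn ℝ ∞ f O) (i j : Fin n) :
    Set.EqOn (pderiv i (pderiv j f)) (pderiv j (pderiv i f)) O := fun x hx => by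
  have hd : DifferentiableAt ℝ (fderiv ℝ f) x :=
    ((contDiffOn_fderiv_of_isOpen hO hf).contDiffAt (hO.mem_nhds hx)).differentiableAt (by simp)
  have key : ∀ i j : Fin n, pderiv i (pderiv j f) x =
      fderiv ℝ (fderiv ℝ f) x (EuclideanSpace.single i 1) (EuclideanSpace.single j 1) := by
    intro i j
    unfold pderiv
    rw [fderiv_clm_apply hd (differentiableAt_const _)]
    simp
  rw [key, key]
  exact (hf.contDiffAt (hO.mem_nhds hx)).isSymmSndFDerivAt
    (by simpa only [minSmoothness_of_isRCLikeNormedField] using ENat.LEInfty.out) _ _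

theorem pderiv_iterate_comm (hO : IsOpen O) (hf : ContDiffOn ℝ ∞ f O) (i j : Fin n) (k : ℕ) :
    Set.EqOn (pderiv i ((pderiv j)^[k] f)) ((pderiv j)^[k] (pderiv i f)) O := by
  induction k with
  | zero => exact fun _ _ => rfl
  | succ k ih =>
    rw [Function.iterate_succ_apply', Function.iterate_succ_apply']
    exact (pderiv_comm hO (iterate_pderiv_contDiffOn hO hf j k) i j).trans (pderiv_eqOn hO ih j)

/-- The partial derivatives prescribed by `σ` in the directions listed in `l`. -/
noncomputable def listPderiv (l : List (Fin n)) (σ : Fin n → ℕ) (f : Euc n → Euc m) :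
    Euc n → Euc m :=
  l.foldr (fun i g => (pderiv i)^[σ i] g) f

theorem listPderiv_contDiffOn (hO : IsOpen O) (hf : ContDiffOn ℝ ∞ f O) (l : List (Fin n))
    (σ : Fin n → ℕ) : ContDiffOn ℝ ∞ (listPderiv l σ f) O := by
  induction l with
  | nil => exact hf
  | cons j l ih => exact iterate_pderiv_contDiffOn hO ih j _

theorem listPderiv_congr (l : List (Fin n)) {σ τ : Fin n → ℕ} (h : ∀ i ∈ l, σ i = τ i) :
    listPderiv l σ f = listPderiv l τ f := by
  induction l with
  | nil => rfl
  | cons j l ih =>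
    change (pderiv j)^[σ j] (listPderiv l σ f) = (pderiv j)^[τ j] (listPderiv l τ f)
    rw [ih fun i hi => h i (List.mem_cons_of_mem _ hi), h j List.mem_cons_self]

/-- By symmetry of second derivatives `∂ᵢ` moves inwards past the other directions until it reaches
its own block. Distinctness of the entries ensures that only one block gains a derivative. -/
theorem pderiv_listPderiv (hO : IsOpen O) (hf : ContDiffOn ℝ ∞ f O) (i : Fin n)
    (l : List (Fin n)) (hl : l.Nodup) (hi : i ∈ l) (σ : Fin n → ℕ) :
    Set.EqOn (pderiv i (listPderiv l σ f)) (listPderiv l (σ + Pi.single i 1) f) O := by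
  induction l with
  | nil => simp at hi
  | cons j l ih =>
    change Set.EqOn (pderiv i ((pderiv j)^[σ j] (listPderiv l σ f)))
      ((pderiv j)^[(σ + Pi.single i 1 : Fin n → ℕ) j] (listPderiv l (σ + Pi.single i 1) f)) O
    rw [List.nodup_cons] at hl
    rcases eq_or_ne i j with rfl | hij
    · have h1 : listPderiv l (σ + Pi.single i 1) f = listPderiv l σ f := by
        refine listPderiv_congr l fun a ha => ?_
        have : a ≠ i := fun h => hl.1 (h ▸ ha)
        simp [this]
      rw [h1]
      simp only [Pi.add_apply, Pi.single_eq_same, Function.iterate_succ_apply']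
      exact fun _ _ => rfl
    · have hi' : i ∈ l := (List.mem_cons.1 hi).resolve_left hij
      have h2 : (σ + Pi.single i 1 : Fin n → ℕ) j = σ j := by simp [hij.symm]
      rw [h2]
      exact (pderiv_iterate_comm hO (listPderiv_contDiffOn hO hf l σ) i j _).trans
        (iterate_pderiv_eqOn hO (ih hl.2 hi') j _)

theorem mpderiv_contDiffOn (hO : IsOpen O) (hf : ContDiffOn ℝ ∞ f O) (σ : Fin n → ℕ) :
    ContDiffOn ℝ ∞ (mpderiv σ f) O :=
  listPderiv_contDiffOn hO hf _ σ

theorem pderiv_mpderiv (hO : IsOpen O) (hf : ContDiffOn ℝ ∞ f O) (i : Fin n) (σ : Fin n → ℕ) :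
    Set.EqOn (pderiv i (mpderiv σ f)) (mpderiv (σ + Pi.single i 1) f) O :=
  pderiv_listPderiv hO hf i _ (List.nodup_finRange n) (List.mem_finRange i) σ

theorem mpderiv_zero : mpderiv (0 : Fin n → ℕ) f = f := by
  unfold mpderiv
  generalize List.finRange n = l
  induction l with
  | nil => rfl
  | cons j l ih => exact ih

/-- The derivatives of `mpderiv σ f` are determined by the `mpderiv (σ + 1ᵢ) f`. -/
theorem fderiv_mpderiv_congr {O' : Set (Euc n)} (hO : IsOpen O) (hf : ContDiffOn ℝ ∞ f O)
    (hO' : IsOpen O') (hg : ContDiffOn ℝ ∞ g O') (σ : Fin n → ℕ) {y : Euc n} (hy : y ∈ O)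
    (hy' : y ∈ O')
    (h : ∀ i, mpderiv (σ + Pi.single i 1) f y = mpderiv (σ + Pi.single i 1) g y) :
    fderiv ℝ (mpderiv σ f) y = fderiv ℝ (mpderiv σ g) y := by
  ext1 v
  have hv : v = ∑ i, v i • EuclideanSpace.single i (1 : ℝ) := by
    ext j
    simp [Finset.sum_apply, Pi.single_apply]
  rw [hv, map_sum, map_sum]
  refine Finset.sum_congr rfl fun i _ => ?_
  rw [map_smul, map_smul]
  congr 1
  exact (pderiv_mpderiv hO hf i σ hy).trans ((h i).trans (pderiv_mpderiv hO' hg i σ hy').symm)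

theorem multiIndex_induction {P : (Fin n → ℕ) → Prop} (zero : P 0)
    (step : ∀ σ i, P σ → P (σ + Pi.single i 1)) (σ : Fin n → ℕ) : P σ := by
  have key : ∀ (k : ℕ) (σ : Fin n → ℕ), ∑ i, σ i = k → P σ := by
    intro k
    induction k with
    | zero =>
      intro σ h
      have : σ = 0 := by
        funext i
        exact (Finset.sum_eq_zero_iff.1 h) i (Finset.mem_univ i)
      rwa [this]
    | succ k ih =>
      intro σ h
      obtain ⟨i, -, hi⟩ : ∃ i ∈ Finset.univ, σ i ≠ 0 := by
        apply Finset.exists_ne_zero_of_sum_ne_zero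
        omega
      -- Truncated subtraction is harmless because `σ i ≠ 0`.
      have hσ : (fun j => σ j - (Pi.single i 1 : Fin n → ℕ) j) + Pi.single i 1 = σ := by
        funext j
        rcases eq_or_ne j i with rfl | hj
        · simp; omega
        · simp [hj]
      rw [← hσ]
      refine step _ _ (ih _ ?_)
      have h2 := congrArg (fun τ : Fin n → ℕ => ∑ j, τ j) hσ
      simp only [Pi.add_apply, Finset.sum_add_distrib, Finset.sum_pi_single', Finset.mem_univ,
        if_true] at h2
      omega
  exact key _ σ rfl

theorem sum_add_single (σ : Fin n → ℕ) (i : Fin n) :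
    ∑ j, (σ + Pi.single i 1 : Fin n → ℕ) j = ∑ j, σ j + 1 := by
  simp [Finset.sum_add_distrib]

end Calculus

/-! ### Fibred charts and local sections -/

section Charts

variable {n m : ℕ}
  {M : Type*} [TopologicalSpace M] [ChartedSpace (Euc n) M]
  {E : Type*} [TopologicalSpace E] [ChartedSpace (Euc (n + m)) E] {π : E → M}

/-- A local trivialization followed by a product of charts of `M` and `F` is a fibred chart. -/
theorem IsSmoothFiberBundle.exists_fibredChart [IsManifold (𝓡 n) ∞ M]
    {F : Type*} [TopologicalSpace F] [ChartedSpace (Euc m) F] [IsManifold (𝓡 m) ∞ F]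
    (hπ : IsSmoothFiberBundle n m F π) (e₀ : E) :
    ∃ c : FibredChart n m π, e₀ ∈ c.total.source := by
  obtain ⟨e, ha, he, he'⟩ := hπ (π e₀)
  set x := chartAt (Euc n) (π e₀)
  set u := chartAt (Euc m) (e e₀).2
  have hsrc : (e.toOpenPartialHomeomorph ≫ₕ x.prod u).source =
      e.source ∩ e ⁻¹' (x.source ×ˢ u.source) := by
    rw [OpenPartialHomeomorph.trans_source]; rfl
  have htgt : (e.toOpenPartialHomeomorph ≫ₕ x.prod u).target =
      (x.target ×ˢ u.target) ∩ (x.prod u).symm ⁻¹' e.target := by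
    rw [OpenPartialHomeomorph.trans_target]; rfl
  refine ⟨⟨x, e.toOpenPartialHomeomorph ≫ₕ x.prod u, IsManifold.chart_mem_maximalAtlas _,
    ?_, ?_, ?_, ?_⟩, ?_⟩
  · rw [hsrc]
    have h := he.mono (Set.inter_subset_left (t := e ⁻¹' (x.source ×ˢ u.source)))
    exact ((contMDiffOn_chart (x := π e₀)).comp (contMDiff_fst.comp_contMDiffOn h)
      fun z hz => hz.2.1).prodMk_space
      ((contMDiffOn_chart (x := (e e₀).2)).comp (contMDiff_snd.comp_contMDiffOn h)
        fun z hz => hz.2.2)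
  · rw [htgt]
    refine he'.comp (ContMDiffOn.prodMk
      ((contMDiffOn_chart_symm (x := π e₀)).comp contDiff_fst.contMDiff.contMDiffOn
        fun z hz => hz.1.1)
      ((contMDiffOn_chart_symm (x := (e e₀).2)).comp contDiff_snd.contMDiff.contMDiffOn
        fun z hz => hz.1.2)) fun z hz => hz.2
  · intro z hz
    rw [hsrc] at hz
    have := hz.2.1
    rwa [e.coe_fst hz.1] at this
  · intro z hz
    rw [hsrc] at hz
    exact congrArg x (e.coe_fst hz.1)
  · rw [hsrc]
    have h0 : e₀ ∈ e.source := e.mem_source.2 ha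
    refine ⟨h0, ?_, mem_chart_source _ _⟩
    rw [e.coe_fst h0]
    exact mem_chart_source _ _

theorem IsSmoothFiberBundle.contMDiff
    {F : Type*} [TopologicalSpace F] [ChartedSpace (Euc m) F]
    (hπ : IsSmoothFiberBundle n m F π) : ContMDiff (𝓡 (n + m)) (𝓡 n) ∞ π := by
  intro e₀
  obtain ⟨e, ha, he, -⟩ := hπ (π e₀)
  have h0 : e.source ∈ 𝓝 e₀ := e.open_source.mem_nhds (e.mem_source.2 ha)
  refine ((contMDiff_fst.comp_contMDiffOn he).contMDiffAt h0).congr_of_eventuallyEq ?_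
  filter_upwards [h0] with z hz
  exact (e.coe_fst hz).symm

/-- The points of the chart at which the local representative of `s` is meaningful. -/
def FibredChart.repDom (c : FibredChart n m π) (s : LocalSection n m π) : Set (Euc n) :=
  c.base.target ∩ c.base.symm ⁻¹' ((s.dom : Set M) ∩ s.toFun ⁻¹' c.total.source)

theorem LocalSection.isOpen_inter_preimage (s : LocalSection n m π) {U : Set E} (hU : IsOpen U) :
    IsOpen ((s.dom : Set M) ∩ s.toFun ⁻¹' U) :=
  s.smooth.continuousOn.isOpen_inter_preimage s.dom.isOpen hU

theorem FibredChart.isOpen_repDom (c : FibredChart n m π) (s : LocalSection n m π) :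
    IsOpen (c.repDom s) :=
  c.base.isOpen_inter_preimage_symm (s.isOpen_inter_preimage c.total.open_source)

theorem FibredChart.rep_contDiffOn (c : FibredChart n m π) (s : LocalSection n m π) :
    ContDiffOn ℝ ∞ (c.rep s) (c.repDom s) := by
  rw [← contMDiffOn_iff_contDiffOn]
  have h1 : ContMDiffOn 𝓘(ℝ, Euc n) 𝓘(ℝ, Euc n × Euc m) ∞
      (fun x => c.total (s.toFun (c.base.symm x))) (c.repDom s) :=
    c.smooth_total.comp (s.smooth.comp
      ((contMDiffOn_symm_of_mem_maximalAtlas c.base_mem).mono Set.inter_subset_left)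
      fun x hx => hx.2.1) fun x hx => hx.2.2
  exact (contDiff_snd.contMDiff (n := ∞)).comp_contMDiffOn h1

theorem FibredChart.mem_base_source (c : FibredChart n m π) (s : LocalSection n m π) {a : M}
    (ha : a ∈ s.dom) (hc : s.toFun a ∈ c.total.source) : a ∈ c.base.source := by
  simpa only [s.isSection a ha] using c.proj_mem _ hc

theorem FibredChart.base_mem_repDom (c : FibredChart n m π) (s : LocalSection n m π) {a : M}
    (ha : a ∈ s.dom) (hc : s.toFun a ∈ c.total.source) : c.base a ∈ c.repDom s := by
  have h := c.mem_base_source s ha hc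
  refine ⟨c.base.map_source h, ?_⟩
  rw [Set.mem_preimage, c.base.left_inv h]
  exact ⟨ha, hc⟩

/-- Jet equivalence requires agreement in every fibred chart around the value, so the arbitrary
representative inside `jetCoord` can be exchanged for `s`. -/
theorem FibredChart.jetCoord_jet (c : FibredChart n m π) (s : LocalSection n m π) (k : ℕ) {a : M}
    (ha : a ∈ s.dom) (hc : s.toFun a ∈ c.total.source) :
    c.jetCoord (s.jet k a ha) = (c.base a, fun σ => mpderiv σ.1 (c.rep s) (c.base a)) := by
  have h : (jetSetoid n m π k).r (Quotient.out (s.jet k a ha)) ⟨a, s, ha⟩ :=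
    Quotient.exact (Quotient.out_eq (s.jet k a ha))
  unfold FibredChart.jetCoord
  obtain ⟨h1, h2, h3⟩ := h
  refine Prod.ext (congrArg c.base h1) (funext fun σ => ?_)
  exact h3 c (by rw [h2]; exact hc) σ.1 σ.2

/-- A local section read in jet coordinates. -/
noncomputable def FibredChart.jetMap (c : FibredChart n m π) (s : LocalSection n m π) (k : ℕ) :
    Euc n → JetCoord n m k :=
  fun y => (y, fun σ => mpderiv σ.1 (c.rep s) y)

theorem FibredChart.jetMap_contDiffOn (c : FibredChart n m π) (s : LocalSection n m π) (k : ℕ) :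
    ContDiffOn ℝ ∞ (c.jetMap s k) (c.repDom s) :=
  contDiffOn_id.prodMk (contDiffOn_pi.2 fun σ =>
    mpderiv_contDiffOn (c.isOpen_repDom s) (c.rep_contDiffOn s) σ.1)

/-- Differentiating derivatives of order at most `k` produces only derivatives of order at most `k +
1`. This is why a total derivative raises the order by one. -/
theorem FibredChart.fderiv_jetMap_congr (c : FibredChart n m π) (s t : LocalSection n m π) (k : ℕ)
    {y : Euc n} (hs : y ∈ c.repDom s) (ht : y ∈ c.repDom t)
    (h : ∀ σ : Fin n → ℕ, ∑ i, σ i ≤ k + 1 → mpderiv σ (c.rep s) y = mpderiv σ (c.rep t) y) :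
    fderiv ℝ (c.jetMap s k) y = fderiv ℝ (c.jetMap t k) y := by
  have key : ∀ s : LocalSection n m π, y ∈ c.repDom s → fderiv ℝ (c.jetMap s k) y =
      (ContinuousLinearMap.id ℝ (Euc n)).prod (ContinuousLinearMap.pi fun σ : MultiIndex n k =>
        fderiv ℝ (mpderiv σ.1 (c.rep s)) y) := by
    intro s hs
    refine HasFDerivAt.fderiv ((hasFDerivAt_id y).prodMk (hasFDerivAt_pi.2 fun σ => ?_))
    exact (((mpderiv_contDiffOn (c.isOpen_repDom s) (c.rep_contDiffOn s) σ.1).contDiffAt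
      ((c.isOpen_repDom s).mem_nhds hs)).differentiableAt (by simp)).hasFDerivAt
  rw [key s hs, key t ht]
  congr 2
  funext σ
  refine fderiv_mpderiv_congr (c.isOpen_repDom s) (c.rep_contDiffOn s) (c.isOpen_repDom t)
    (c.rep_contDiffOn t) σ.1 hs ht fun i => h _ ?_
  rw [sum_add_single]
  exact Nat.succ_le_succ σ.2

/-- The multi-index `0`. -/
def MultiIndex.zero (n k : ℕ) : MultiIndex n k := ⟨0, by simp⟩

theorem Jet.exists_rep {k : ℕ} (θ : Jet n m π k) :
    ∃ (s : LocalSection n m π) (h : θ.base ∈ s.dom), s.jet k θ.base h = θ := by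
  obtain ⟨⟨a, s, ha⟩, rfl⟩ := Quotient.exists_rep θ
  exact ⟨s, ha, rfl⟩

theorem FibredChart.total_target (c : FibredChart n m π) {k : ℕ} (θ : Jet n m π k)
    (h : θ.target ∈ c.total.source) :
    c.total θ.target = ((c.jetCoord θ).1, (c.jetCoord θ).2 (MultiIndex.zero n k)) := by
  obtain ⟨⟨a, s, ha⟩, rfl⟩ := Quotient.exists_rep θ
  change s.toFun a ∈ c.total.source at h
  have h1 := c.jetCoord_jet s k ha h
  change c.jetCoord (⟦⟨a, s, ha⟩⟧) = _ at h1
  rw [h1]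
  refine Prod.ext ?_ ?_
  · exact (c.fst_eq _ h).trans (congrArg c.base (s.isSection a ha))
  · change (c.total (s.toFun a)).2 = mpderiv (0 : Fin n → ℕ) (c.rep s) (c.base a)
    rw [mpderiv_zero, FibredChart.rep, c.base.left_inv (c.mem_base_source s ha h)]

/-- The coordinates `(x, u)` among the jet coordinates. -/
def zeroCoord (n m k : ℕ) (z : JetCoord n m k) : Euc n × Euc m := (z.1, z.2 (MultiIndex.zero n k))

theorem zeroCoord_contDiff (k : ℕ) : ContDiff ℝ ∞ (zeroCoord n m k) :=
  contDiff_fst.prodMk ((contDiff_apply ℝ (Euc m) (MultiIndex.zero n k)).comp contDiff_snd)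

theorem FibredChart.symm_zeroCoord (c : FibredChart n m π) {k : ℕ} (θ : Jet n m π k)
    (h : θ.target ∈ c.total.source) :
    zeroCoord n m k (c.jetCoord θ) ∈ c.total.target ∧
      c.total.symm (zeroCoord n m k (c.jetCoord θ)) = θ.target := by
  have h1 : zeroCoord n m k (c.jetCoord θ) = c.total θ.target := (c.total_target θ h).symm
  rw [h1]
  exact ⟨c.total.map_source h, c.total.left_inv h⟩

/-! ### Smooth functions on jet spaces -/

theorem isSmoothOnJet_target (hc : ∀ e : E, ∃ c : FibredChart n m π, e ∈ c.total.source)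
    {g : E → ℝ} (hg : ContMDiff (𝓡 (n + m)) 𝓘(ℝ, ℝ) ∞ g) (k : ℕ) :
    IsSmoothOnJet k fun θ : Jet n m π k => g θ.target := by
  intro θ
  obtain ⟨c, h⟩ := hc θ.target
  refine ⟨c, h, fun z => g (c.total.symm (zeroCoord n m k z)), zeroCoord n m k ⁻¹' c.total.target,
    c.total.open_target.preimage (zeroCoord_contDiff k).continuous, (c.symm_zeroCoord θ h).1,
    ?_, ?_⟩
  · have := hg.comp_contMDiffOn c.smooth_symm
    exact (contMDiffOn_iff_contDiffOn.1 this).comp (zeroCoord_contDiff k).contDiffOn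
      fun z hz => hz
  · intro η hη _
    beta_reduce
    rw [(c.symm_zeroCoord η hη).2]

theorem isSmoothOnJet_cutoff (hc : ∀ e : E, ∃ c : FibredChart n m π, e ∈ c.total.source)
    (c : FibredChart n m π) {χ : E → ℝ} (hχ : ContMDiff (𝓡 (n + m)) 𝓘(ℝ, ℝ) ∞ χ)
    (hsupp : tsupport χ ⊆ c.total.source) (k : ℕ) {H : JetCoord n m k → ℝ}
    (hH : ContDiff ℝ ∞ H) :
    IsSmoothOnJet k fun θ : Jet n m π k => χ θ.target * H (c.jetCoord θ) := by
  intro θ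
  by_cases h : θ.target ∈ c.total.source
  · refine ⟨c, h, fun z => χ (c.total.symm (zeroCoord n m k z)) * H z,
      zeroCoord n m k ⁻¹' c.total.target,
      c.total.open_target.preimage (zeroCoord_contDiff k).continuous, (c.symm_zeroCoord θ h).1,
      ?_, ?_⟩
    · have := hχ.comp_contMDiffOn c.smooth_symm
      exact ((contMDiffOn_iff_contDiffOn.1 this).comp (zeroCoord_contDiff k).contDiffOn
        fun z hz => hz).mul hH.contDiffOn
    · intro η hη _
      beta_reduce
      rw [(c.symm_zeroCoord η hη).2]
  -- Outside the domain of `c` the values of `c.jetCoord` are meaningless, but there the cutoff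
  -- vanishes on a neighbourhood, seen in another chart.
  · obtain ⟨c', h'⟩ := hc θ.target
    have hO : IsOpen (c'.total.target ∩ c'.total.symm ⁻¹' (tsupport χ)ᶜ) :=
      c'.total.isOpen_inter_preimage_symm (isClosed_tsupport χ).isOpen_compl
    refine ⟨c', h', fun _ => 0, _, hO.preimage (zeroCoord_contDiff k).continuous, ?_,
      contDiffOn_const, ?_⟩
    · obtain ⟨h1, h2⟩ := c'.symm_zeroCoord θ h'
      refine ⟨h1, ?_⟩
      rw [Set.mem_preimage, h2]
      exact fun h3 => h (hsupp h3)
    · intro η hη hη'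
      have h4 := hη'.2
      rw [Set.mem_preimage, (c'.symm_zeroCoord η hη).2] at h4
      simp only [image_eq_zero_of_notMem_tsupport h4, zero_mul]

/-- The projection `π_{∞,0} : J^∞(π) → E`. -/
def JetInf.target (θ : JetInf n m π) : E := (θ.1 0).target

theorem Jet.base_proj {h k : ℕ} (hk : k ≤ h) (θ : Jet n m π h) :
    (Jet.proj hk θ).base = θ.base := by
  obtain ⟨p, rfl⟩ := Quotient.exists_rep θ
  rfl

theorem Jet.target_proj {h k : ℕ} (hk : k ≤ h) (θ : Jet n m π h) :
    (Jet.proj hk θ).target = θ.target := by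
  obtain ⟨p, rfl⟩ := Quotient.exists_rep θ
  rfl

theorem JetInf.base_coe (θ : JetInf n m π) (k : ℕ) : (θ.1 k).base = θ.base := by
  rw [JetInf.base, ← θ.2 k 0 (Nat.zero_le k), Jet.base_proj]

theorem JetInf.target_coe (θ : JetInf n m π) (k : ℕ) : (θ.1 k).target = θ.target := by
  rw [JetInf.target, ← θ.2 k 0 (Nat.zero_le k), Jet.target_proj]

theorem JetInf.proj_target (θ : JetInf n m π) : π θ.target = θ.base := by
  obtain ⟨⟨a, s, ha⟩, h⟩ := Quotient.exists_rep (θ.1 0)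
  rw [JetInf.target, JetInf.base, ← h]
  exact s.isSection a ha

theorem JetInf.exists_rep (θ : JetInf n m π) (K : ℕ) :
    ∃ (s : LocalSection n m π) (h : θ.base ∈ s.dom), s.jet K θ.base h = θ.1 K := by
  rw [← θ.base_coe K]
  exact (θ.1 K).exists_rep

theorem JetInf.jet_of_le {θ : JetInf n m π} {s : LocalSection n m π} {a : M} {ha : a ∈ s.dom}
    {h k : ℕ} (hk : k ≤ h) (H : s.jet h a ha = θ.1 h) : s.jet k a ha = θ.1 k := by
  rw [← θ.2 h k hk, ← H]
  rfl

theorem JetInf.toFun_of_jet {θ : JetInf n m π} {s : LocalSection n m π} {a : M} {ha : a ∈ s.dom}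
    {k : ℕ} (H : s.jet k a ha = θ.1 k) : s.toFun a = θ.target := by
  rw [← θ.target_coe k, ← H]
  rfl

/-- A smooth function on `E`, as a function on `J^∞(π)`. -/
def SmoothFun.ofTarget (hc : ∀ e : E, ∃ c : FibredChart n m π, e ∈ c.total.source)
    (g : E → ℝ) (hg : ContMDiff (𝓡 (n + m)) 𝓘(ℝ, ℝ) ∞ g) : SmoothFun n m π :=
  ⟨fun θ => g θ.target, 0, _, isSmoothOnJet_target hc hg 0, fun _ => rfl⟩

/-- A smooth function on `M`, as a function on `J^∞(π)`. -/
def SmoothFun.ofBase (hc : ∀ e : E, ∃ c : FibredChart n m π, e ∈ c.total.source)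
    (hπ : ContMDiff (𝓡 (n + m)) (𝓡 n) ∞ π)
    (g : M → ℝ) (hg : ContMDiff (𝓡 n) 𝓘(ℝ, ℝ) ∞ g) : SmoothFun n m π :=
  ⟨fun θ => g θ.base, 0, _, isSmoothOnJet_target hc (hg.comp hπ) 0,
    fun θ => congrArg g θ.proj_target.symm⟩

/-! ### Derivatives along local sections -/

/-- The local expression of `f ∘ s^(∞)`: smoothness and the chain rule for it reduce to calculus on
`ℝⁿ`. -/
theorem LocalSection.pullback_eventuallyEq (s : LocalSection n m π) {f : JetInf n m π → ℝ} {k : ℕ}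
    {g : Jet n m π k → ℝ} (hfg : ∀ θ, f θ = g (θ.1 k)) {a : M} (ha : a ∈ s.dom)
    (c : FibredChart n m π) (hc : s.toFun a ∈ c.total.source) {G : JetCoord n m k → ℝ}
    {O : Set (JetCoord n m k)} (hO : IsOpen O) (haO : c.jetCoord (s.jet k a ha) ∈ O)
    (hG : ∀ η : Jet n m π k, η.target ∈ c.total.source → c.jetCoord η ∈ O →
      g η = G (c.jetCoord η)) :
    s.pullback f =ᶠ[𝓝 a] fun x => G (c.jetMap s k (c.base x)) := by
  have h1 : (s.dom : Set M) ∩ s.toFun ⁻¹' c.total.source ∈ 𝓝 a :=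
    (s.isOpen_inter_preimage c.total.open_source).mem_nhds ⟨ha, hc⟩
  have h2 : ContinuousAt (fun x => c.jetMap s k (c.base x)) a :=
    ContinuousAt.comp (f := c.base) (g := c.jetMap s k)
      ((c.jetMap_contDiffOn s k).continuousOn.continuousAt
        ((c.isOpen_repDom s).mem_nhds (c.base_mem_repDom s ha hc)))
      (c.base.continuousAt (c.mem_base_source s ha hc))
  rw [c.jetCoord_jet s k ha hc] at haO
  filter_upwards [h1, h2.preimage_mem_nhds (hO.mem_nhds haO)] with x hx hx'
  have hx1 : x ∈ s.dom := hx.1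
  have h3 := c.jetCoord_jet s k hx1 hx.2
  simp only [LocalSection.pullback, dif_pos hx1, hfg]
  change g (s.jet k x hx1) = _
  rw [hG (s.jet k x hx1) hx.2 (by rw [h3]; exact hx'), h3]
  rfl

theorem FibredChart.base_mdifferentiableAt [IsManifold (𝓡 n) ∞ M] (c : FibredChart n m π) {a : M}
    (ha : a ∈ c.base.source) : MDifferentiableAt (𝓡 n) 𝓘(ℝ, Euc n) c.base a :=
  (contMDiffAt_of_mem_maximalAtlas c.base_mem ha).mdifferentiableAt (by simp)

theorem LocalSection.pullback_contMDiffAt [IsManifold (𝓡 n) ∞ M] (s : LocalSection n m π)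
    (f : SmoothFun n m π) {a : M} (ha : a ∈ s.dom) :
    ContMDiffAt (𝓡 n) 𝓘(ℝ, ℝ) ∞ (s.pullback f.1) a := by
  obtain ⟨k, g, hg, hfg⟩ := f.2
  obtain ⟨c, hc, G, O, hO, haO, hGs, hG⟩ := hg (s.jet k a ha)
  refine ContMDiffAt.congr_of_eventuallyEq ?_ (s.pullback_eventuallyEq hfg ha c hc hO haO hG)
  rw [c.jetCoord_jet s k ha hc] at haO
  have h1 : ContDiffAt ℝ ∞ (fun y => G (c.jetMap s k y)) (c.base a) :=
    ContDiffAt.comp (g := G) (f := c.jetMap s k) (c.base a) (hGs.contDiffAt (hO.mem_nhds haO))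
      ((c.jetMap_contDiffOn s k).contDiffAt
        ((c.isOpen_repDom s).mem_nhds (c.base_mem_repDom s ha hc)))
  exact h1.contMDiffAt.comp a
    (contMDiffAt_of_mem_maximalAtlas c.base_mem (c.mem_base_source s ha hc))

theorem SmoothFun.exists_mfderiv_congr [IsManifold (𝓡 n) ∞ M] (f : SmoothFun n m π) :
    ∃ K : ℕ, ∀ (s t : LocalSection n m π) (a : M) (hs : a ∈ s.dom) (ht : a ∈ t.dom),
      s.jet K a hs = t.jet K a ht →
      mfderiv (𝓡 n) 𝓘(ℝ, ℝ) (s.pullback f.1) a = mfderiv (𝓡 n) 𝓘(ℝ, ℝ) (t.pullback f.1) a := by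
  obtain ⟨k, g, hg, hfg⟩ := f.2
  refine ⟨k + 1, fun s t a hs ht hst => ?_⟩
  have hst' : s.jet k a hs = t.jet k a ht := congrArg (Jet.proj (Nat.le_succ k)) hst
  obtain ⟨-, hval, hjet⟩ := Quotient.exact hst
  obtain ⟨c, hc, G, O, hO, haO, hGs, hG⟩ := hg (s.jet k a hs)
  change s.toFun a ∈ c.total.source at hc
  change s.toFun a = t.toFun a at hval
  have hc' : t.toFun a ∈ c.total.source := hval ▸ hc
  have haO' : c.jetCoord (t.jet k a ht) ∈ O := hst' ▸ haO
  have hder : ∀ (s : LocalSection n m π) (hs : a ∈ s.dom), s.toFun a ∈ c.total.source →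
      c.jetCoord (s.jet k a hs) ∈ O →
      mfderiv (𝓡 n) 𝓘(ℝ, ℝ) (s.pullback f.1) a =
        ((fderiv ℝ G (c.jetCoord (s.jet k a hs))).comp (fderiv ℝ (c.jetMap s k) (c.base a))).comp
          (mfderiv (𝓡 n) 𝓘(ℝ, Euc n) c.base a) := by
    intro s hs hc haO
    rw [(s.pullback_eventuallyEq hfg hs c hc hO haO hG).mfderiv_eq]
    rw [c.jetCoord_jet s k hs hc] at haO ⊢
    have h1 : HasFDerivAt (fun y => G (c.jetMap s k y)) _ (c.base a) :=
      HasFDerivAt.comp (g := G) (f := c.jetMap s k) (c.base a)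
        ((hGs.contDiffAt (hO.mem_nhds haO)).differentiableAt (by simp)).hasFDerivAt
        (((c.jetMap_contDiffOn s k).contDiffAt ((c.isOpen_repDom s).mem_nhds
          (c.base_mem_repDom s hs hc))).differentiableAt (by simp)).hasFDerivAt
    exact (h1.hasMFDerivAt.comp a
      (c.base_mdifferentiableAt (c.mem_base_source s hs hc)).hasMFDerivAt).mfderiv
  rw [hder s hs hc haO, hder t ht hc' haO', hst', c.fderiv_jetMap_congr s t k
    (c.base_mem_repDom s hs hc) (c.base_mem_repDom t ht hc') (hjet c hc)]

end Charts

/-! ### Smooth maps of manifolds -/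

section Manifolds

variable {d n : ℕ}
  {N : Type*} [TopologicalSpace N] [ChartedSpace (Euc d) N]
  {M : Type*} [TopologicalSpace M] [ChartedSpace (Euc n) M]

theorem exists_contMDiff_bump [T2Space M] [IsManifold (𝓡 n) ∞ M] (a : M) {U : Set M}
    (hU : U ∈ 𝓝 a) : ∃ χ : M → ℝ, ContMDiff (𝓡 n) 𝓘(ℝ, ℝ) ∞ χ ∧ χ =ᶠ[𝓝 a] 1 ∧ tsupport χ ⊆ U := by
  obtain ⟨f, -, hf⟩ := (SmoothBumpFunction.nhds_basis_tsupport (I := 𝓡 n) a).mem_iff.1 hU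
  exact ⟨f, f.contMDiff, f.eventuallyEq_one, hf⟩

/-- This turns a coordinate, defined only locally, into a global function that can be pulled back to
`𝓕(π)`. -/
theorem exists_contMDiff_eventuallyEq_coord [T2Space M] [IsManifold (𝓡 n) ∞ M] (a : M)
    (i : Fin n) : ∃ g : M → ℝ, ContMDiff (𝓡 n) 𝓘(ℝ, ℝ) ∞ g ∧
      g =ᶠ[𝓝 a] fun x => chartAt (Euc n) a x i := by
  obtain ⟨f, -, -⟩ :=
    (SmoothBumpFunction.nhds_basis_tsupport (I := 𝓡 n) a).mem_iff.1 Filter.univ_mem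
  refine ⟨fun x => f x • chartAt (Euc n) a x i, f.contMDiff_smul ?_, ?_⟩
  · exact ((EuclideanSpace.proj (𝕜 := ℝ) i).contDiff.contMDiff (n := ∞)).comp_contMDiffOn
      (contMDiffOn_chart (x := a))
  · filter_upwards [f.eventuallyEq_one] with x hx
    simp [hx]

/-- Tangent vectors at `a` are by convention written in the preferred chart at `a`, whose
differential there is therefore the identity. -/
theorem mfderiv_coord [IsManifold (𝓡 n) ∞ M] (a : M) (i : Fin n) (w : TangentSpace (𝓡 n) a) :
    mfderiv (𝓡 n) 𝓘(ℝ, ℝ) (fun x => chartAt (Euc n) a x i) a w = (show Euc n from w) i := by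
  have : IsManifold (𝓡 n) 1 M := IsManifold.of_le (n := ∞) (by exact ENat.LEInfty.out)
  have h1 : HasMFDerivAt (𝓡 n) 𝓘(ℝ, Euc n) (chartAt (Euc n) a) a
      (ContinuousLinearMap.id ℝ (TangentSpace (𝓡 n) a)) := by
    have h2 := (mdifferentiableAt_extChartAt (I := 𝓡 n) (mem_chart_source (Euc n) a)).hasMFDerivAt
    rw [mfderiv_extChartAt_self] at h2
    exact h2
  have h3 : HasMFDerivAt (𝓡 n) 𝓘(ℝ, ℝ)
      ((EuclideanSpace.proj (𝕜 := ℝ) i : Euc n →L[ℝ] ℝ) ∘ chartAt (Euc n) a) a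
      ((EuclideanSpace.proj (𝕜 := ℝ) i : Euc n →L[ℝ] ℝ).comp
        (ContinuousLinearMap.id ℝ (Euc n))) :=
    (EuclideanSpace.proj (𝕜 := ℝ) i : Euc n →L[ℝ] ℝ).hasMFDerivAt.comp a h1
  have h4 := h3.mfderiv
  exact congrArg (fun L : Euc n →L[ℝ] ℝ => L w) h4

/-- A map into a manifold is smooth at a point if its composition with every smooth function is. -/
theorem contMDiffAt_of_forall_comp [T2Space M] [IsManifold (𝓡 n) ∞ M] {φ : N → M} {p : N}
    (h : ∀ g : M → ℝ, ContMDiff (𝓡 n) 𝓘(ℝ, ℝ) ∞ g →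
      ContMDiffAt (𝓡 d) 𝓘(ℝ, ℝ) ∞ (fun q => g (φ q)) p) :
    ContMDiffAt (𝓡 d) (𝓡 n) ∞ φ p := by
  -- Continuity is not assumed: a bump function supported in `U` stays nonzero along `φ` near `p`,
  -- which forces `φ` into `U`.
  have hcont : ContinuousAt φ p := by
    intro U hU
    obtain ⟨χ, hχ, h1, hsupp⟩ := exists_contMDiff_bump (n := n) (φ p) hU
    have h2 : ∀ᶠ q in 𝓝 p, χ (φ q) ≠ 0 :=
      (h χ hχ).continuousAt.eventually_ne (by simp [h1.eq_of_nhds])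
    exact h2.mono fun q hq => hsupp (subset_tsupport _ hq)
  rw [contMDiffAt_iff_target]
  refine ⟨hcont, ?_⟩
  have h3 : ContMDiffAt (𝓡 d) 𝓘(ℝ, Fin n → ℝ) ∞
      (fun q => (EuclideanSpace.equiv (Fin n) ℝ) (chartAt (Euc n) (φ p) (φ q))) p := by
    rw [contMDiffAt_pi_space]
    intro i
    obtain ⟨g, hg, hgi⟩ := exists_contMDiff_eventuallyEq_coord (n := n) (φ p) i
    exact (h g hg).congr_of_eventuallyEq ((hcont.eventually hgi).mono fun q hq => hq.symm)
  have h4 := ((EuclideanSpace.equiv (Fin n) ℝ).symm.contDiff.contMDiff (n := ∞)).contMDiffAt.comp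
    p h3
  exact h4

/-- The inverse function theorem for maps of manifolds. -/
theorem exists_local_inverse [IsManifold (𝓡 d) ∞ N] [IsManifold (𝓡 n) ∞ M] {φ : N → M} {p : N}
    {W : Set N} (hW : IsOpen W) (hp : p ∈ W) (hφ : ContMDiffOn (𝓡 d) (𝓡 n) ∞ φ W)
    (hbij : Function.Bijective (mfderiv (𝓡 d) (𝓡 n) φ p)) :
    ∃ e : OpenPartialHomeomorph N M, p ∈ e.source ∧ e.source ⊆ W ∧ Set.EqOn e φ e.source ∧
      ContMDiffOn (𝓡 n) (𝓡 d) ∞ e.symm e.target := by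
  set x := chartAt (Euc d) p with hx
  set y := chartAt (Euc n) (φ p) with hy
  let f : Euc d → Euc n := fun z => y (φ (x.symm z))
  let W₁ : Set N := W ∩ φ ⁻¹' y.source
  have hW₁ : IsOpen W₁ := hφ.continuousOn.isOpen_inter_preimage hW y.open_source
  let S : Set (Euc d) := x.target ∩ x.symm ⁻¹' W₁
  have hS : IsOpen S := x.isOpen_inter_preimage_symm hW₁
  have hpS : x p ∈ S := by
    refine ⟨x.map_source (mem_chart_source _ _), ?_⟩
    rw [Set.mem_preimage, x.left_inv (mem_chart_source _ _)]
    exact ⟨hp, mem_chart_source _ _⟩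
  have hf : ContDiffOn ℝ ∞ f S := by
    rw [← contMDiffOn_iff_contDiffOn]
    exact (contMDiffOn_chart (x := φ p)).comp (hφ.comp
      ((contMDiffOn_chart_symm (x := p)).mono Set.inter_subset_left) fun z hz => hz.2.1)
      fun z hz => hz.2.2
  have hder : fderiv ℝ f (x p) = mfderiv (𝓡 d) (𝓡 n) φ p := by
    have h1 : MDifferentiableAt (𝓡 d) (𝓡 n) φ p :=
      (hφ.contMDiffAt (hW.mem_nhds hp)).mdifferentiableAt (by simp)
    refine Eq.trans ?_ h1.mfderiv.symm
    simp only [mfld_simps, fderivWithin_univ]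
    rfl
  let L : Euc d ≃L[ℝ] Euc n :=
    (LinearEquiv.ofBijective (fderiv ℝ f (x p)).toLinearMap
      (by rw [hder]; exact hbij)).toContinuousLinearEquiv
  have hL : (L : Euc d →L[ℝ] Euc n) = fderiv ℝ f (x p) := by ext1 v; rfl
  have hfp : ContDiffAt ℝ ∞ f (x p) := hf.contDiffAt (hS.mem_nhds hpS)
  have hfp' : HasFDerivAt f (L : Euc d →L[ℝ] Euc n) (x p) := by
    rw [hL]; exact (hfp.differentiableAt (by simp)).hasFDerivAt
  let h := hfp.toOpenPartialHomeomorph f hfp' (by simp)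
  -- Smoothness of the inverse is needed on its whole domain and not only at the image of `p`, so
  -- the source is shrunk to the open set where the differential is invertible.
  let T : Set (Euc d) := S ∩ fderiv ℝ f ⁻¹' Set.range ((↑) : (Euc d ≃L[ℝ] Euc n) → _)
  have hT : IsOpen T := (contDiffOn_fderiv_of_isOpen hS hf).continuousOn.isOpen_inter_preimage hS
    ContinuousLinearEquiv.isOpen
  have hpT : x p ∈ T := ⟨hpS, L, hL⟩
  let h' := h.restrOpen T hT
  have hsrc : h'.source = h.source ∩ T := h.restrOpen_source T hT
  have hsymm : ContDiffOn ℝ ∞ h'.symm h'.target := by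
    intro z hz
    have hz' : h'.symm z ∈ T := (hsrc ▸ h'.map_target hz).2
    obtain ⟨hzS, L', hL'⟩ := hz'
    have hd := hf.contDiffAt (hS.mem_nhds hzS)
    refine (h'.contDiffAt_symm (f₀' := L') hz ?_ hd).contDiffWithinAt
    rw [hL']
    exact (hd.differentiableAt (by simp)).hasFDerivAt
  have hmaps : ∀ z ∈ h'.source, h' z ∈ y.target := fun z hz => y.map_source (hsrc ▸ hz).2.1.2.2
  have hmem : ∀ q ∈ ((x ≫ₕ h') ≫ₕ y.symm).source, q ∈ x.source ∧ x q ∈ h'.source := by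
    intro q hq
    rw [OpenPartialHomeomorph.trans_source, OpenPartialHomeomorph.trans_source] at hq
    exact hq.1
  have hT1 : ∀ q, q ∈ x.source → x q ∈ h'.source → q ∈ W₁ := by
    intro q hq hq'
    have := (hsrc ▸ hq').2.1.2
    rwa [Set.mem_preimage, x.left_inv hq] at this
  refine ⟨(x ≫ₕ h') ≫ₕ y.symm, ?_, ?_, ?_, ?_⟩
  · have h1 : x p ∈ h'.source := by
      rw [hsrc]
      exact ⟨hfp.mem_toOpenPartialHomeomorph_source hfp' (by simp), hpT⟩
    rw [OpenPartialHomeomorph.trans_source, OpenPartialHomeomorph.trans_source]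
    exact ⟨⟨mem_chart_source _ _, h1⟩, hmaps _ h1⟩
  · intro q hq
    exact (hT1 q (hmem q hq).1 (hmem q hq).2).1
  · intro q hq
    obtain ⟨h1, h2⟩ := hmem q hq
    change y.symm (y (φ (x.symm (x q)))) = φ q
    rw [x.left_inv h1, y.left_inv (hT1 q h1 h2).2]
  · have htgt : ∀ z ∈ ((x ≫ₕ h') ≫ₕ y.symm).target,
        z ∈ y.source ∧ y z ∈ h'.target ∧ h'.symm (y z) ∈ x.target := by
      intro z hz
      rw [OpenPartialHomeomorph.trans_target, OpenPartialHomeomorph.trans_target] at hz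
      exact ⟨hz.1, hz.2.1, hz.2.2⟩
    exact (contMDiffOn_chart_symm (x := p)).comp
      ((contMDiffOn_iff_contDiffOn.2 hsymm).comp
        ((contMDiffOn_chart (x := φ p)).mono fun z hz => (htgt z hz).1)
        fun z hz => (htgt z hz).2.1) fun z hz => (htgt z hz).2.2

end Manifolds

/-! ### Total derivatives and Cartan planes -/

section Cartan

variable {n m : ℕ}
  {M : Type*} [TopologicalSpace M] [ChartedSpace (Euc n) M]
  {E : Type*} [TopologicalSpace E] [ChartedSpace (Euc (n + m)) E] {π : E → M}

/-- The two defining orders may differ; a section realizing `θ` to the larger order computes both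
values. -/
theorem HasTotalDeriv.unique {f : JetInf n m π → ℝ} {θ : JetInf n m π}
    {w : TangentSpace (𝓡 n) θ.base} {c c' : ℝ} (h : HasTotalDeriv f θ w c)
    (h' : HasTotalDeriv f θ w c') : c = c' := by
  obtain ⟨K, hK⟩ := h
  obtain ⟨K', hK'⟩ := h'
  obtain ⟨s, hs, H⟩ := θ.exists_rep (max K K')
  exact (hK s hs (JetInf.jet_of_le (le_max_left _ _) H)).2.symm.trans
    (hK' s hs (JetInf.jet_of_le (le_max_right _ _) H)).2

theorem HasTotalDeriv.totalDeriv_eq {f : JetInf n m π → ℝ} {θ : JetInf n m π} {i : Fin n} {c : ℝ}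
    (h : HasTotalDeriv f θ (EuclideanSpace.single i (1 : ℝ) : Euc n) c) :
    totalDeriv i f θ = c := by
  have h' : ∃ c, HasTotalDeriv f θ (EuclideanSpace.single i (1 : ℝ) : Euc n) c := ⟨c, h⟩
  rw [totalDeriv, dif_pos h']
  exact h'.choose_spec.unique h

theorem LocalSection.pullback_ofBase_eventuallyEq (s : LocalSection n m π) {a : M} (ha : a ∈ s.dom)
    (g : M → ℝ) : s.pullback (fun θ => g θ.base) =ᶠ[𝓝 a] g := by
  filter_upwards [s.dom.isOpen.mem_nhds ha] with x hx
  have hx' : x ∈ s.dom := hx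
  rw [LocalSection.pullback, dif_pos hx']
  rfl

variable [IsManifold (𝓡 n) ∞ M]

/-- No section realizing all orders of `θ` at once is needed: one with the right `K`-jet gives `D`,
and any other with that jet gives the same differential. -/
theorem SmoothFun.exists_jetDeriv (f : SmoothFun n m π) (θ : JetInf n m π) :
    ∃ D : TangentSpace (𝓡 n) θ.base →L[ℝ] ℝ, ∃ K : ℕ, ∀ (s : LocalSection n m π)
      (h : θ.base ∈ s.dom), s.jet K θ.base h = θ.1 K →
      mfderiv (𝓡 n) 𝓘(ℝ, ℝ) (s.pullback f.1) θ.base = D := by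
  obtain ⟨K, hK⟩ := f.exists_mfderiv_congr
  obtain ⟨t, ht, H⟩ := θ.exists_rep K
  exact ⟨mfderiv (𝓡 n) 𝓘(ℝ, ℝ) (t.pullback f.1) θ.base, K,
    fun s hs H' => hK s t _ hs ht (H'.trans H.symm)⟩

/-- The total differential of a smooth function at `θ`. -/
noncomputable def SmoothFun.jetDeriv (f : SmoothFun n m π) (θ : JetInf n m π) :
    TangentSpace (𝓡 n) θ.base →L[ℝ] ℝ :=
  (f.exists_jetDeriv θ).choose

theorem SmoothFun.jetDeriv_spec (f : SmoothFun n m π) (θ : JetInf n m π) :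
    ∃ K : ℕ, ∀ (s : LocalSection n m π) (h : θ.base ∈ s.dom), s.jet K θ.base h = θ.1 K →
      mfderiv (𝓡 n) 𝓘(ℝ, ℝ) (s.pullback f.1) θ.base = f.jetDeriv θ :=
  (f.exists_jetDeriv θ).choose_spec

theorem SmoothFun.hasTotalDeriv (f : SmoothFun n m π) (θ : JetInf n m π)
    (w : TangentSpace (𝓡 n) θ.base) : HasTotalDeriv f.1 θ w (f.jetDeriv θ w) := by
  obtain ⟨K, hK⟩ := f.jetDeriv_spec θ
  refine ⟨K, fun s h H => ⟨(s.pullback_contMDiffAt f h).mdifferentiableAt (by simp), ?_⟩⟩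
  exact congrArg (fun L : TangentSpace (𝓡 n) θ.base →L[ℝ] ℝ => L w) (hK s h H)

theorem SmoothFun.jetDeriv_prolong (f : SmoothFun n m π) (s : LocalSection n m π) (x : s.dom) :
    f.jetDeriv (s.prolong x) = mfderiv (𝓡 n) 𝓘(ℝ, ℝ) (s.pullback f.1) x.1 := by
  obtain ⟨K, hK⟩ := f.jetDeriv_spec (s.prolong x)
  exact (hK s x.2 rfl).symm

/-- The total differential is linear in `w`, so the span of the `Dᵢ` consists of all the `D_w`. -/
theorem mem_cartan_iff {θ : JetInf n m π} {v : SmoothFun n m π → ℝ} :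
    v ∈ cartan θ ↔ ∃ w : TangentSpace (𝓡 n) θ.base, v = fun f => f.jetDeriv θ w := by
  have h1 : ∀ (i : Fin n) (f : SmoothFun n m π), totalDeriv i f.1 θ =
      f.jetDeriv θ (EuclideanSpace.single i (1 : ℝ) : Euc n) :=
    fun i f => (f.hasTotalDeriv θ _).totalDeriv_eq
  have h2 : ∀ w : Euc n, w = ∑ i, w i • (EuclideanSpace.single i (1 : ℝ) : Euc n) := by
    intro w
    ext j
    simp [Finset.sum_apply, Pi.single_apply]
  have h3 : ∀ (f : SmoothFun n m π) (c : Fin n → ℝ),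
      f.jetDeriv θ (∑ i, c i • (EuclideanSpace.single i (1 : ℝ) : Euc n) : Euc n) =
        ∑ i, c i * totalDeriv i f.1 θ := by
    intro f c
    simp only [h1]
    refine (map_sum (f.jetDeriv θ) _ _).trans (Finset.sum_congr rfl fun i _ => ?_)
    exact map_smul (f.jetDeriv θ) (c i) (EuclideanSpace.single i (1 : ℝ) : Euc n)
  rw [cartan, Submodule.mem_span_range_iff_exists_fun]
  constructor
  · rintro ⟨c, rfl⟩
    refine ⟨(∑ i, c i • (EuclideanSpace.single i (1 : ℝ) : Euc n) : Euc n), ?_⟩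
    funext f
    rw [h3]
    simp [Finset.sum_apply]
  · rintro ⟨w, rfl⟩
    refine ⟨fun i => (show Euc n from w) i, ?_⟩
    funext f
    rw [h2 w, h3, ← h2 w]
    simp [Finset.sum_apply]

theorem SmoothFun.jetDeriv_ofBase (hc : ∀ e : E, ∃ c : FibredChart n m π, e ∈ c.total.source)
    (hπ : ContMDiff (𝓡 (n + m)) (𝓡 n) ∞ π) {g : M → ℝ} (hg : ContMDiff (𝓡 n) 𝓘(ℝ, ℝ) ∞ g)
    (θ : JetInf n m π) :
    (SmoothFun.ofBase hc hπ g hg).jetDeriv θ = mfderiv (𝓡 n) 𝓘(ℝ, ℝ) g θ.base := by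
  obtain ⟨K, hK⟩ := (SmoothFun.ofBase hc hπ g hg).jetDeriv_spec θ
  obtain ⟨s, hs, H⟩ := θ.exists_rep K
  rw [← hK s hs H]
  exact (s.pullback_ofBase_eventuallyEq hs g).mfderiv_eq

/-- Tangent vectors are separated by the smooth functions on the manifold. -/
theorem tangent_ext [T2Space M] {a : M} {w w' : TangentSpace (𝓡 n) a}
    (h : ∀ g : M → ℝ, ContMDiff (𝓡 n) 𝓘(ℝ, ℝ) ∞ g →
      mfderiv (𝓡 n) 𝓘(ℝ, ℝ) g a w = mfderiv (𝓡 n) 𝓘(ℝ, ℝ) g a w') : w = w' := by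
  refine PiLp.ext (p := 2) (x := (show Euc n from w)) (y := (show Euc n from w')) fun i => ?_
  obtain ⟨g, hg, hgi⟩ := exists_contMDiff_eventuallyEq_coord (n := n) a i
  have := h g hg
  rw [hgi.mfderiv_eq] at this
  exact (mfderiv_coord a i w).symm.trans (this.trans (mfderiv_coord a i w'))

end Cartan

/-! ### Integral manifolds transversal to the fibres are prolongations -/

section Prolongation

variable {n m : ℕ}
  {M : Type*} [TopologicalSpace M] [ChartedSpace (Euc n) M]
  {E : Type*} [TopologicalSpace E] [ChartedSpace (Euc (n + m)) E] {π : E → M}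

theorem JetInf.exists_rep_at (θ : JetInf n m π) (K : ℕ) {a : M} (ha : θ.base = a) :
    ∃ (s : LocalSection n m π) (h : a ∈ s.dom), s.jet K a h = θ.1 K := by
  subst ha
  exact θ.exists_rep K

/-- `σ` as a multi-index of order at most `|σ|`. -/
def MultiIndex.self (σ : Fin n → ℕ) : MultiIndex n (∑ i, σ i) := ⟨σ, le_rfl⟩

/-- The coordinate `u_σ` of a fibred chart on `J^∞(π)`. -/
noncomputable def FibredChart.coord (c : FibredChart n m π) (σ : Fin n → ℕ) (θ : JetInf n m π) :
    Euc m :=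
  (c.jetCoord (θ.1 (∑ i, σ i))).2 (MultiIndex.self σ)

theorem FibredChart.coord_eq (c : FibredChart n m π) {σ : Fin n → ℕ} {θ : JetInf n m π}
    {s : LocalSection n m π} {a : M} {ha : a ∈ s.dom} {k : ℕ} (H : s.jet k a ha = θ.1 k)
    (hσ : ∑ i, σ i ≤ k) (hc : s.toFun a ∈ c.total.source) :
    c.coord σ θ = mpderiv σ (c.rep s) (c.base a) := by
  rw [FibredChart.coord, ← JetInf.jet_of_le hσ H, c.jetCoord_jet s _ ha hc]
  rfl

/-- A coordinate `u^j_σ`, multiplied by a function on `E` supported in the chart. -/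
noncomputable def SmoothFun.cutoffCoord
    (hc : ∀ e : E, ∃ c : FibredChart n m π, e ∈ c.total.source)
    (c : FibredChart n m π) {χ : E → ℝ} (hχ : ContMDiff (𝓡 (n + m)) 𝓘(ℝ, ℝ) ∞ χ)
    (hsupp : tsupport χ ⊆ c.total.source) (σ : Fin n → ℕ) (j : Fin m) : SmoothFun n m π :=
  ⟨fun θ => χ θ.target * c.coord σ θ j, ∑ i, σ i, _,
    isSmoothOnJet_cutoff hc c hχ hsupp (∑ i, σ i)
      (((EuclideanSpace.proj (𝕜 := ℝ) j : Euc m →L[ℝ] ℝ).contDiff.comp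
        (contDiff_apply ℝ (Euc m) (MultiIndex.self σ))).comp contDiff_snd),
    fun θ => congrArg (fun e => χ e * c.coord σ θ j) (θ.target_coe (∑ i, σ i)).symm⟩

theorem FibredChart.mfderiv_base_surjective (c : FibredChart n m π) {a : M}
    (ha : a ∈ c.base.source) :
    Function.Surjective (mfderiv (𝓡 n) 𝓘(ℝ, Euc n) c.base a) := by
  have h : c.base.MDifferentiable (𝓡 n) 𝓘(ℝ, Euc n) :=
    ⟨(contMDiffOn_of_mem_maximalAtlas c.base_mem).mdifferentiableOn (by simp),
      (contMDiffOn_symm_of_mem_maximalAtlas c.base_mem).mdifferentiableOn (by simp)⟩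
  exact h.mfderiv_surjective ha

theorem pderiv_apply_coord {f : Euc n → Euc m} {y : Euc n} (hf : DifferentiableAt ℝ f y)
    (i : Fin n) (j : Fin m) :
    pderiv i f y j = fderiv ℝ (fun z => f z j) y (EuclideanSpace.single i 1) := by
  have h : HasFDerivAt (fun z => f z j)
      ((EuclideanSpace.proj (𝕜 := ℝ) j : Euc m →L[ℝ] ℝ).comp (fderiv ℝ f y)) y :=
    (EuclideanSpace.proj (𝕜 := ℝ) j : Euc m →L[ℝ] ℝ).hasFDerivAt.comp y hf.hasFDerivAt
  rw [h.fderiv]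
  rfl

theorem FibredChart.mpderiv_rep_differentiableAt (c : FibredChart n m π) (s : LocalSection n m π)
    (σ : Fin n → ℕ) {a : M} (ha : a ∈ s.dom) (hc : s.toFun a ∈ c.total.source) :
    DifferentiableAt ℝ (mpderiv σ (c.rep s)) (c.base a) :=
  ((mpderiv_contDiffOn (c.isOpen_repDom s) (c.rep_contDiffOn s) σ).contDiffAt
    ((c.isOpen_repDom s).mem_nhds (c.base_mem_repDom s ha hc))).differentiableAt (by simp)

variable [IsManifold (𝓡 n) ∞ M]

theorem FibredChart.mfderiv_mpderiv_comp_base (c : FibredChart n m π) (s : LocalSection n m π)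
    (σ : Fin n → ℕ) (j : Fin m) {a : M} (ha : a ∈ s.dom) (hc : s.toFun a ∈ c.total.source)
    (w : TangentSpace (𝓡 n) a) :
    mfderiv (𝓡 n) 𝓘(ℝ, ℝ) (fun x => mpderiv σ (c.rep s) (c.base x) j) a w =
      fderiv ℝ (fun z => mpderiv σ (c.rep s) z j) (c.base a)
        (mfderiv (𝓡 n) 𝓘(ℝ, Euc n) c.base a w) := by
  have h1 : DifferentiableAt ℝ (fun z => mpderiv σ (c.rep s) z j) (c.base a) :=
    (EuclideanSpace.proj (𝕜 := ℝ) j : Euc m →L[ℝ] ℝ).differentiableAt.comp _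
      (c.mpderiv_rep_differentiableAt s σ ha hc)
  have h2 := (h1.hasFDerivAt.hasMFDerivAt.comp a
    (c.base_mdifferentiableAt (c.mem_base_source s ha hc)).hasMFDerivAt).mfderiv
  exact congrArg (fun L : TangentSpace (𝓡 n) a →L[ℝ] ℝ => L w) h2

/-- A family of infinite jets over an open set, which is smooth and whose tangent planes are the
Cartan planes, is the prolongation of a local section. -/
theorem exists_prolong_eq [T2Space E] [IsManifold (𝓡 (n + m)) ∞ E]
    (hc : ∀ e : E, ∃ c : FibredChart n m π, e ∈ c.total.source)
    (V : TopologicalSpace.Opens M) (h : M → JetInf n m π) (hbase : ∀ x ∈ V, (h x).base = x)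
    (hsmooth : ∀ f : SmoothFun n m π, ContMDiffOn (𝓡 n) 𝓘(ℝ, ℝ) ∞ (fun x => f.1 (h x)) V)
    (hder : ∀ (f : SmoothFun n m π), ∀ x ∈ V, ∃ K : ℕ, ∀ (s : LocalSection n m π) (hs : x ∈ s.dom),
      s.jet K x hs = (h x).1 K → ∀ w : TangentSpace (𝓡 n) x,
        mfderiv (𝓡 n) 𝓘(ℝ, ℝ) (s.pullback f.1) x w =
          mfderiv (𝓡 n) 𝓘(ℝ, ℝ) (fun y => f.1 (h y)) x w) :
    ∃ s : LocalSection n m π, s.dom = V ∧ ∀ (x : M) (hx : x ∈ s.dom), h x = s.prolong ⟨x, hx⟩ := by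
  let s' : LocalSection n m π :=
    { dom := V
      toFun := fun x => (h x).target
      smooth := fun x hx => (contMDiffAt_of_forall_comp (M := E) fun g hg =>
        (hsmooth (SmoothFun.ofTarget hc g hg)).contMDiffAt
          (V.isOpen.mem_nhds hx)).contMDiffWithinAt
      isSection := fun x hx => (h x).proj_target.trans (hbase x hx) }
  -- The chart and the point stay universally quantified: equality of jets involves every chart, and
  -- the induction step differentiates the hypothesis, which must hold on a neighbourhood.
  have key : ∀ (c : FibredChart n m π) (σ : Fin n → ℕ) (x : M), x ∈ V →
      s'.toFun x ∈ c.total.source → mpderiv σ (c.rep s') (c.base x) = c.coord σ (h x) := by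
    intro c σ
    induction σ using multiIndex_induction with
    | zero =>
      intro x hx hxc
      obtain ⟨s, hs, H⟩ := (h x).exists_rep_at 0 (hbase x hx)
      have hval : s.toFun x = s'.toFun x := JetInf.toFun_of_jet H
      have hsc : s.toFun x ∈ c.total.source := hval ▸ hxc
      rw [c.coord_eq H (by simp) hsc, mpderiv_zero, mpderiv_zero, FibredChart.rep,
        FibredChart.rep, c.base.left_inv (c.mem_base_source s hs hsc), hval]
    | step σ i ih =>
      intro x hx hxc
      have hx' : x ∈ s'.dom := hx
      obtain ⟨χ, hχ, hχ1, hsupp⟩ := exists_contMDiff_bump (n := n + m) (s'.toFun x)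
        (c.total.open_source.mem_nhds hxc)
      rw [← pderiv_mpderiv (c.isOpen_repDom s') (c.rep_contDiffOn s') i σ
        (c.base_mem_repDom s' hx' hxc)]
      have hnear : ∀ s : LocalSection n m π, x ∈ s.dom → s.toFun x = s'.toFun x →
          ∀ᶠ y in 𝓝 x, y ∈ s.dom ∧ s.toFun y ∈ c.total.source ∧ χ (s.toFun y) = 1 := by
        intro s hs hval
        have hcont : ContinuousAt s.toFun x :=
          (s.smooth.contMDiffAt (s.dom.isOpen.mem_nhds hs)).continuousAt
        have h1 : ∀ᶠ e in 𝓝 (s.toFun x), χ e = 1 := by rw [hval]; exact hχ1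
        have h2 : ∀ᶠ e in 𝓝 (s.toFun x), e ∈ c.total.source := by
          rw [hval]; exact c.total.open_source.mem_nhds hxc
        filter_upwards [s.dom.isOpen.mem_nhds hs, hcont.eventually h1, hcont.eventually h2]
          with y hy1 hy2 hy3
        exact ⟨hy1, hy3, hy2⟩
      let f : Fin m → SmoothFun n m π := fun j => SmoothFun.cutoffCoord hc c hχ hsupp σ j
      choose K hK using fun j => hder (f j) x hx
      -- The order is large enough for the tangency condition of all `m` components and for reading
      -- off `u_{σ+1ᵢ}`.
      obtain ⟨s, hs, H⟩ := (h x).exists_rep_at (Finset.univ.sup K + ((∑ i, σ i) + 1)) (hbase x hx)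
      have hval : s.toFun x = s'.toFun x := JetInf.toFun_of_jet H
      have hsc : s.toFun x ∈ c.total.source := hval ▸ hxc
      have hstep : c.coord (σ + Pi.single i 1) (h x) =
          pderiv i (mpderiv σ (c.rep s)) (c.base x) := by
        rw [pderiv_mpderiv (c.isOpen_repDom s) (c.rep_contDiffOn s) i σ
          (c.base_mem_repDom s hs hsc)]
        refine c.coord_eq H ?_ hsc
        rw [sum_add_single]
        exact Nat.le_add_left _ _
      rw [hstep]
      ext j
      rw [pderiv_apply_coord (c.mpderiv_rep_differentiableAt s' σ hx' hxc),
        pderiv_apply_coord (c.mpderiv_rep_differentiableAt s σ hs hsc)]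
      -- `w` is `∂/∂xᵢ` for the coordinates of `c`, which need not be the preferred ones at `x`.
      obtain ⟨w, hw⟩ := c.mfderiv_base_surjective (c.mem_base_source s hs hsc)
        (EuclideanSpace.single i (1 : ℝ) : Euc n)
      have hKj : K j ≤ Finset.univ.sup K + ((∑ i, σ i) + 1) :=
        (Finset.le_sup (f := K) (Finset.mem_univ j)).trans (Nat.le_add_right _ _)
      have h1 := hK j s hs (JetInf.jet_of_le hKj H) w
      have h2 : s.pullback (f j).1 =ᶠ[𝓝 x] fun y => mpderiv σ (c.rep s) (c.base y) j := by
        filter_upwards [hnear s hs hval] with y ⟨hy1, hy2, hy3⟩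
        rw [LocalSection.pullback, dif_pos hy1]
        change χ (s.toFun y) * c.coord σ (s.prolong ⟨y, hy1⟩) j = _
        have hj : s.jet (∑ i, σ i) y hy1 = (s.prolong ⟨y, hy1⟩).1 (∑ i, σ i) := rfl
        rw [hy3, one_mul, c.coord_eq hj le_rfl hy2]
      have h3 : (fun y => (f j).1 (h y)) =ᶠ[𝓝 x]
          fun y => mpderiv σ (c.rep s') (c.base y) j := by
        filter_upwards [hnear s' hx' rfl] with y ⟨hy1, hy2, hy3⟩
        rw [ih y hy1 hy2]
        change χ (s'.toFun y) * c.coord σ (h y) j = _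
        rw [hy3, one_mul]
      rw [h2.mfderiv_eq, h3.mfderiv_eq] at h1
      have h4 := (c.mfderiv_mpderiv_comp_base s' σ j hx' hxc w).symm.trans
        (h1.symm.trans (c.mfderiv_mpderiv_comp_base s σ j hs hsc w))
      rw [hw] at h4
      exact h4
  refine ⟨s', rfl, fun x hx => Subtype.ext (funext fun k => ?_)⟩
  obtain ⟨s, hs, H⟩ := (h x).exists_rep_at k (hbase x hx)
  have hval : s.toFun x = s'.toFun x := JetInf.toFun_of_jet H
  rw [← H]
  refine Quotient.sound ⟨rfl, hval, fun c hcs σ hσ => ?_⟩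
  change s.toFun x ∈ c.total.source at hcs
  change mpderiv σ (c.rep s) (c.base x) = mpderiv σ (c.rep s') (c.base x)
  rw [key c σ x hx (hval ▸ hcs), c.coord_eq H hσ hcs]

/-- The base point is freed because for a reparametrized family of jets it equals the parameter only
propositionally. -/
theorem SmoothFun.jetDeriv_spec_at (f : SmoothFun n m π) (θ : JetInf n m π) {a : M}
    (ha : θ.base = a) :
    ∃ K : ℕ, ∀ (s : LocalSection n m π) (h : a ∈ s.dom), s.jet K a h = θ.1 K → ∀ w : Euc n,
      mfderiv (𝓡 n) 𝓘(ℝ, ℝ) (s.pullback f.1) a w = f.jetDeriv θ w := by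
  subst ha
  obtain ⟨K, hK⟩ := f.jetDeriv_spec θ
  exact ⟨K, fun s h H w =>
    congrArg (fun L : TangentSpace (𝓡 n) θ.base →L[ℝ] ℝ => L w) (hK s h H)⟩

variable {d : ℕ} {N : Type*} [TopologicalSpace N] [ChartedSpace (Euc d) N]

theorem base_comp_contMDiffOn [T2Space M]
    (hc : ∀ e : E, ∃ c : FibredChart n m π, e ∈ c.total.source)
    (hπ : ContMDiff (𝓡 (n + m)) (𝓡 n) ∞ π) {ι : N → JetInf n m π} {W : Set N} (hW : IsOpen W)
    (hsmooth : ∀ f : SmoothFun n m π, ContMDiffOn (𝓡 d) 𝓘(ℝ, ℝ) ∞ (fun q => f.1 (ι q)) W) :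
    ContMDiffOn (𝓡 d) (𝓡 n) ∞ (fun q => (ι q).base) W := fun _ hq =>
  (contMDiffAt_of_forall_comp fun g hg =>
    (hsmooth (SmoothFun.ofBase hc hπ g hg)).contMDiffAt (hW.mem_nhds hq)).contMDiffWithinAt

/-- Inverting `π_∞ ∘ ι` locally makes `ι` a family of jets over the base, to which
`exists_prolong_eq` applies. Working on an open `W` also covers families that are meaningful only on
the domain of a section. -/
theorem isProlongationNear_of_bijective [T2Space M] [T2Space E]
    [IsManifold (𝓡 (n + m)) ∞ E] [IsManifold (𝓡 d) ∞ N]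
    (hc : ∀ e : E, ∃ c : FibredChart n m π, e ∈ c.total.source)
    (hπ : ContMDiff (𝓡 (n + m)) (𝓡 n) ∞ π) {ι : N → JetInf n m π} {W : Set N} (hW : IsOpen W)
    (hsmooth : ∀ f : SmoothFun n m π, ContMDiffOn (𝓡 d) 𝓘(ℝ, ℝ) ∞ (fun q => f.1 (ι q)) W)
    (htan : ∀ (f : SmoothFun n m π), ∀ q ∈ W, ∀ X : TangentSpace (𝓡 d) q,
      mfderiv (𝓡 d) 𝓘(ℝ, ℝ) (fun q => f.1 (ι q)) q X =
        f.jetDeriv (ι q) (mfderiv (𝓡 d) (𝓡 n) (fun q => (ι q).base) q X))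
    {p : N} (hp : p ∈ W)
    (hbij : Function.Bijective (mfderiv (𝓡 d) (𝓡 n) (fun q => (ι q).base) p)) :
    ∃ U : Set N, IsOpen U ∧ p ∈ U ∧ U ⊆ W ∧ ∃ s : LocalSection n m π,
      Set.BijOn (fun q => (ι q).base) U (s.dom : Set M) ∧
      ∀ q ∈ U, ∀ h : (ι q).base ∈ s.dom, ι q = s.prolong ⟨(ι q).base, h⟩ := by
  have hφ := base_comp_contMDiffOn hc hπ hW hsmooth
  obtain ⟨e, hpe, heW, heq, hsymm⟩ := exists_local_inverse hW hp hφ hbij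
  have hmem : ∀ x ∈ e.target, e.symm x ∈ W := fun x hx => heW (e.map_target hx)
  have hbase : ∀ x ∈ e.target, (ι (e.symm x)).base = x := fun x hx =>
    (heq (e.map_target hx)).symm.trans (e.right_inv hx)
  obtain ⟨s, hs, H⟩ := exists_prolong_eq hc ⟨e.target, e.open_target⟩ (fun x => ι (e.symm x))
    hbase (fun f => (hsmooth f).comp hsymm hmem) (by
      intro f x hx
      obtain ⟨K, hK⟩ := f.jetDeriv_spec_at (ι (e.symm x)) (hbase x hx)
      refine ⟨K, fun s hs hjet w => (hK s hs hjet w).trans ?_⟩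
      have he : HasMFDerivAt (𝓡 n) (𝓡 d) e.symm x (mfderiv (𝓡 n) (𝓡 d) e.symm x) :=
        ((hsymm.contMDiffAt (e.open_target.mem_nhds hx)).mdifferentiableAt (by simp)).hasMFDerivAt
      have hq := hW.mem_nhds (hmem x hx)
      have h1 := ((((hsmooth f).contMDiffAt hq).mdifferentiableAt
        (by simp)).hasMFDerivAt.comp x he).mfderiv
      have h2 := ((hφ.contMDiffAt hq).mdifferentiableAt (by simp)).hasMFDerivAt.comp x he
      -- The reparametrized family lies over the identity, so its Cartan vector in direction `w` is
      -- exactly `D_w`.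
      have h3 : HasMFDerivAt (𝓡 n) (𝓡 n) ((fun q => (ι q).base) ∘ e.symm) x
          (ContinuousLinearMap.id ℝ (TangentSpace (𝓡 n) x)) := by
        refine (hasMFDerivAt_id x).congr_of_eventuallyEq ?_
        filter_upwards [e.open_target.mem_nhds hx] with y hy
        exact hbase y hy
      have h4 := hasMFDerivAt_unique h2 h3
      have h5 : (mfderiv (𝓡 d) (𝓡 n) (fun q => (ι q).base) (e.symm x)
          (mfderiv (𝓡 n) (𝓡 d) e.symm x w) : Euc n) = w :=
        congrArg (fun L : Euc n →L[ℝ] Euc n => L w) h4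
      have h6 := htan f (e.symm x) (hmem x hx) (mfderiv (𝓡 n) (𝓡 d) e.symm x w)
      have h7 : mfderiv (𝓡 n) 𝓘(ℝ, ℝ) (fun y => f.1 (ι (e.symm y))) x w =
          mfderiv (𝓡 d) 𝓘(ℝ, ℝ) (fun q => f.1 (ι q)) (e.symm x)
            (mfderiv (𝓡 n) (𝓡 d) e.symm x w) :=
        congrArg (fun L : Euc n →L[ℝ] ℝ => L w) h1
      rw [h7, h6]
      exact congrArg (fun v : Euc n => f.jetDeriv (ι (e.symm x)) v) h5.symm)
  have hs' : (s.dom : Set M) = e.target :=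
    congrArg (fun V : TopologicalSpace.Opens M => (V : Set M)) hs
  refine ⟨e.source, e.open_source, hpe, heW, s, ?_, fun q hq h => ?_⟩
  · rw [hs']
    exact e.bijOn.congr heq
  · rw [← H]
    have : e.symm (ι q).base = q := by
      rw [← show e q = (ι q).base from heq hq]
      exact e.left_inv hq
    rw [this]

/-- A smooth map to `J^∞(π)` tangent to a Cartan plane is tangent to it along its projection. -/
theorem mfderiv_eq_jetDeriv_of_mem_cartan [T2Space M]
    (hc : ∀ e : E, ∃ c : FibredChart n m π, e ∈ c.total.source)
    (hπ : ContMDiff (𝓡 (n + m)) (𝓡 n) ∞ π) {ι : N → JetInf n m π} {q : N}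
    (hφ : MDifferentiableAt (𝓡 d) (𝓡 n) (fun q => (ι q).base) q) {X : TangentSpace (𝓡 d) q}
    (hX : pushTangent ι q X ∈ cartan (ι q)) (f : SmoothFun n m π) :
    mfderiv (𝓡 d) 𝓘(ℝ, ℝ) (fun q => f.1 (ι q)) q X =
      f.jetDeriv (ι q) (mfderiv (𝓡 d) (𝓡 n) (fun q => (ι q).base) q X) := by
  obtain ⟨w, hw⟩ := mem_cartan_iff.1 hX
  -- On functions coming from the base, `D_w` is ordinary differentiation along `w`, and these
  -- functions separate tangent vectors.
  have h1 : w = mfderiv (𝓡 d) (𝓡 n) (fun q => (ι q).base) q X := by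
    refine tangent_ext fun g hg => ?_
    have h2 := congrFun hw (SmoothFun.ofBase hc hπ g hg)
    rw [SmoothFun.jetDeriv_ofBase] at h2
    refine h2.symm.trans ?_
    exact congrArg (fun L : TangentSpace (𝓡 d) q →L[ℝ] ℝ => L X)
      (mfderiv_comp q (hg.contMDiffAt.mdifferentiableAt (by simp)) hφ)
  rw [← h1]
  exact congrFun hw f

end Prolongation

/-! ### Integral manifolds with the independence condition -/

section Transversality

variable {n m d : ℕ}
  {M : Type*} [TopologicalSpace M] [ChartedSpace (Euc n) M] [IsManifold (𝓡 n) ∞ M]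
  {E : Type*} [TopologicalSpace E] [ChartedSpace (Euc (n + m)) E] {π : E → M}
  {N : Type*} [TopologicalSpace N] [ChartedSpace (Euc d) N]

theorem mfderiv_coord_comp {φ : N → M} {p : N} (hφ : MDifferentiableAt (𝓡 d) (𝓡 n) φ p)
    (i : Fin n) (X : TangentSpace (𝓡 d) p) :
    mfderiv (𝓡 d) 𝓘(ℝ, ℝ) (fun q => chartAt (Euc n) (φ p) (φ q) i) p X =
      (show Euc n from mfderiv (𝓡 d) (𝓡 n) φ p X) i := by
  have h1 : MDifferentiableAt (𝓡 n) 𝓘(ℝ, ℝ) (fun x => chartAt (Euc n) (φ p) x i) (φ p) :=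
    (EuclideanSpace.proj (𝕜 := ℝ) i : Euc n →L[ℝ] ℝ).mdifferentiableAt.comp (φ p)
      ((contMDiffOn_chart (I := 𝓡 n) (n := ∞) (x := φ p)).contMDiffAt
        (chart_source_mem_nhds _ _) |>.mdifferentiableAt (by simp))
  refine Eq.trans ?_ (mfderiv_coord (φ p) i (mfderiv (𝓡 d) (𝓡 n) φ p X))
  exact congrArg (fun L : TangentSpace (𝓡 d) p →L[ℝ] ℝ => L X) (mfderiv_comp p h1 hφ)

/-- Immersivity gives injectivity and the independence condition gives surjectivity; applied to the
differential of `π_∞ ∘ ι`, this forces `dim N = n`. -/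
theorem bijective_of_det_ne_zero {V : Type*} [AddCommGroup V] [Module ℝ V]
    (L : V →ₗ[ℝ] Euc n) (hL : ∀ X, L X = 0 → X = 0) (v : Fin n → V)
    (hv : (Matrix.of fun i j : Fin n => L (v j) i).det ≠ 0) : Function.Bijective L := by
  refine ⟨(injective_iff_map_eq_zero L).2 hL, fun u => ?_⟩
  set A := Matrix.of fun i j : Fin n => L (v j) i with hA
  have hu : IsUnit A.det := isUnit_iff_ne_zero.2 hv
  refine ⟨∑ j, (A⁻¹.mulVec u.ofLp) j • v j, ?_⟩
  rw [map_sum]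
  ext i
  have h1 : A.mulVec (A⁻¹.mulVec u.ofLp) = u.ofLp := by
    rw [Matrix.mulVec_mulVec, Matrix.mul_nonsing_inv _ hu, Matrix.one_mulVec]
  have h2 := congrFun h1 i
  rw [← h2, Matrix.mulVec, dotProduct]
  simp [hA, Finset.sum_apply, mul_comm]

/-- An integral manifold subject to the independence condition is locally a prolongation. -/
theorem IsIntegralManifold.isProlongationNear [T2Space M] [T2Space E] [IsManifold (𝓡 (n + m)) ∞ E]
    [IsManifold (𝓡 d) ∞ N]
    (hc : ∀ e : E, ∃ c : FibredChart n m π, e ∈ c.total.source)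
    (hπ : ContMDiff (𝓡 (n + m)) (𝓡 n) ∞ π) {ι : N → JetInf n m π} (hι : IsIntegralManifold d ι)
    (hind : IndependenceCondition d ι) (p : N) : IsProlongationNear ι p := by
  obtain ⟨hsm, himm, hcart⟩ := hι
  have hsm' : ∀ f : SmoothFun n m π, ContMDiffOn (𝓡 d) 𝓘(ℝ, ℝ) ∞ (fun q => f.1 (ι q)) Set.univ :=
    fun f => (hsm f).contMDiffOn
  have hφ : ∀ q, MDifferentiableAt (𝓡 d) (𝓡 n) (fun q => (ι q).base) q := fun q =>
    ((base_comp_contMDiffOn hc hπ isOpen_univ hsm').contMDiffAt Filter.univ_mem).mdifferentiableAt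
      (by simp)
  have htan := fun q (X : TangentSpace (𝓡 d) q) =>
    mfderiv_eq_jetDeriv_of_mem_cartan hc hπ (hφ q) (hcart q X)
  have hbij : Function.Bijective (mfderiv (𝓡 d) (𝓡 n) (fun q => (ι q).base) p) := by
    obtain ⟨v, hv⟩ := hind p
    refine bijective_of_det_ne_zero
      (mfderiv (𝓡 d) (𝓡 n) (fun q => (ι q).base) p).toLinearMap (fun X hX => ?_) v ?_
    -- A vector killed by the projection has zero push-forward, since that push-forward is a Cartan
    -- vector over it.
    · refine himm p X (funext fun f => ?_)
      have hX' : mfderiv (𝓡 d) (𝓡 n) (fun q => (ι q).base) p X = 0 := hX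
      refine (htan p X f).trans ?_
      rw [hX', map_zero]
      rfl
    · convert hv using 3
      funext i j
      exact (mfderiv_coord_comp (hφ p) i (v j)).symm
  obtain ⟨U, hU, hpU, -, s, hs⟩ := isProlongationNear_of_bijective hc hπ isOpen_univ hsm'
    (fun f q _ X => htan q X f) (Set.mem_univ p) hbij
  exact ⟨U, hU, hpU, s, hs⟩

end Transversality

/-! ### Push-forward of Cartan vectors by `𝓒`-morphisms -/

section Morphism

variable {n m m' : ℕ}
  {M : Type*} [TopologicalSpace M] [ChartedSpace (Euc n) M]
  {E : Type*} [TopologicalSpace E] [ChartedSpace (Euc (n + m)) E] {π : E → M}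
  {M' : Type*} [TopologicalSpace M'] [ChartedSpace (Euc n) M']
  {E' : Type*} [TopologicalSpace E'] [ChartedSpace (Euc (n + m')) E'] {π' : E' → M'}

theorem pushTangent_comp_mem_cartan {d : ℕ} {N : Type*} [TopologicalSpace N]
    [ChartedSpace (Euc d) N] {B : JetInf n m π → JetInf n m' π'} (hB : IsCMorphism B)
    {ι : N → JetInf n m π} {p : N} {X : TangentSpace (𝓡 d) p}
    (hX : pushTangent ι p X ∈ cartan (ι p)) :
    pushTangent (fun q => B (ι q)) p X ∈ cartan (B (ι p)) := by
  obtain ⟨hB, hcart⟩ := hB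
  exact hcart (ι p) _ hX

end Morphism

/-! ### Regular `𝓒`-morphisms and the matrix `(Dₛξⁱ)` -/

section Regular

variable {n m m' : ℕ}
  {M : Type*} [TopologicalSpace M] [ChartedSpace (Euc n) M] [IsManifold (𝓡 n) ∞ M]
  {E : Type*} [TopologicalSpace E] [ChartedSpace (Euc (n + m)) E] {π : E → M}
  {M' : Type*} [TopologicalSpace M'] [ChartedSpace (Euc n) M'] [IsManifold (𝓡 n) ∞ M']
  [T2Space M']
  {E' : Type*} [TopologicalSpace E'] [ChartedSpace (Euc (n + m')) E'] {π' : E' → M'}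

/-- Near a jet, `ξ^i` is the pull-back of a smooth function on `M'`. -/
theorem hasTotalDeriv_xiComponent
    (hc' : ∀ e : E', ∃ c : FibredChart n m' π', e ∈ c.total.source)
    (hπ' : ContMDiff (𝓡 (n + m')) (𝓡 n) ∞ π')
    {B : JetInf n m π → JetInf n m' π'} (hB : IsSmoothMap B) (θ : JetInf n m π) (i : Fin n)
    {g : M' → ℝ} (hg : ContMDiff (𝓡 n) 𝓘(ℝ, ℝ) ∞ g)
    (hgi : g =ᶠ[𝓝 (B θ).base] fun x => chartAt (Euc n) (B θ).base x i)
    (w : TangentSpace (𝓡 n) θ.base) :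
    HasTotalDeriv (xiComponent B (B θ).base i) θ w
      ((hB.pullback (SmoothFun.ofBase hc' hπ' g hg)).jetDeriv θ w) := by
  obtain ⟨χ, hχ, hχ1, hsupp⟩ := exists_contMDiff_bump (n := n) (B θ).base hgi
  obtain ⟨K, hK⟩ := (hB.pullback (SmoothFun.ofBase hc' hπ' g hg)).hasTotalDeriv θ w
  set f := hB.pullback (SmoothFun.ofBase hc' hπ' χ hχ) with hf
  obtain ⟨k, g', -, hfg⟩ := f.2
  -- Order `K` serves the derivative of the globalized coordinate. Order `k` ensures that the cutoff
  -- along `s^(∞)` has at the base point its value at `θ`, namely `1`.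
  refine ⟨max K k, fun s hs H => ?_⟩
  have h1 := hK s hs (JetInf.jet_of_le (le_max_left _ _) H)
  have hval : s.pullback f.1 θ.base = 1 := by
    rw [LocalSection.pullback, dif_pos hs, hfg]
    change g' (s.jet k θ.base hs) = 1
    rw [JetInf.jet_of_le (le_max_right _ _) H, ← hfg]
    exact hχ1.eq_of_nhds
  have heq : s.pullback (xiComponent B (B θ).base i) =ᶠ[𝓝 θ.base]
      s.pullback (hB.pullback (SmoothFun.ofBase hc' hπ' g hg)).1 := by
    -- The cutoff replaces continuity of `B`: where it is nonzero along `s^(∞)`, the image lies in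
    -- the region where `g` is the chosen coordinate.
    have h2 : ∀ᶠ x in 𝓝 θ.base, s.pullback f.1 x ≠ 0 :=
      (s.pullback_contMDiffAt f hs).continuousAt.eventually_ne (by rw [hval]; exact one_ne_zero)
    filter_upwards [s.dom.isOpen.mem_nhds hs, h2] with x hx hx2
    have hx' : x ∈ s.dom := hx
    rw [LocalSection.pullback, dif_pos hx'] at hx2 ⊢
    rw [LocalSection.pullback, dif_pos hx']
    have h3 : χ (B (s.prolong ⟨x, hx'⟩)).base ≠ 0 := hx2
    exact (hsupp (subset_tsupport _ h3) : _).symm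
  refine ⟨h1.1.congr_of_eventuallyEq heq, ?_⟩
  rw [heq.mfderiv_eq]
  exact h1.2

/-- The push-forward of Cartan vectors by a smooth map is given by the matrix `(D_s ξ^i)`. -/
theorem coord_push_eq
    (hc' : ∀ e : E', ∃ c : FibredChart n m' π', e ∈ c.total.source)
    (hπ' : ContMDiff (𝓡 (n + m')) (𝓡 n) ∞ π')
    {B : JetInf n m π → JetInf n m' π'} (hB : IsSmoothMap B) {θ : JetInf n m π}
    {w : TangentSpace (𝓡 n) θ.base} {w' : TangentSpace (𝓡 n) (B θ).base}
    (h : ∀ f : SmoothFun n m' π', (hB.pullback f).jetDeriv θ w = f.jetDeriv (B θ) w') (i : Fin n) :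
    (show Euc n from w') i =
      ∑ s, (show Euc n from w) s * totalDeriv s (xiComponent B (B θ).base i) θ := by
  obtain ⟨g, hg, hgi⟩ := exists_contMDiff_eventuallyEq_coord (n := n) (B θ).base i
  have h1 := h (SmoothFun.ofBase hc' hπ' g hg)
  rw [SmoothFun.jetDeriv_ofBase, hgi.mfderiv_eq] at h1
  refine (mfderiv_coord (B θ).base i w').symm.trans (h1.symm.trans ?_)
  have h2 : w = ∑ s, (show Euc n from w) s • (EuclideanSpace.single s (1 : ℝ) : Euc n) := by
    refine PiLp.ext (p := 2) (x := (show Euc n from w)) fun j => ?_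
    simp [Finset.sum_apply, Pi.single_apply]
  have h3 := congrArg (fun u : Euc n =>
    (hB.pullback (SmoothFun.ofBase hc' hπ' g hg)).jetDeriv θ u) h2
  refine h3.trans ((map_sum ((hB.pullback (SmoothFun.ofBase hc' hπ' g hg)).jetDeriv θ) _ _).trans
    (Finset.sum_congr rfl fun s _ => ?_))
  rw [(hasTotalDeriv_xiComponent hc' hπ' hB θ i hg hgi
    (EuclideanSpace.single s (1 : ℝ) : Euc n)).totalDeriv_eq]
  exact map_smul ((hB.pullback (SmoothFun.ofBase hc' hπ' g hg)).jetDeriv θ) _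
    (EuclideanSpace.single s (1 : ℝ) : Euc n)

theorem IsRegularAt.eq_zero_of_push_eq_zero
    (hc' : ∀ e : E', ∃ c : FibredChart n m' π', e ∈ c.total.source)
    (hπ' : ContMDiff (𝓡 (n + m')) (𝓡 n) ∞ π')
    {B : JetInf n m π → JetInf n m' π'} (hB : IsSmoothMap B) {θ : JetInf n m π}
    (hreg : IsRegularAt B θ) {w : TangentSpace (𝓡 n) θ.base}
    (h : ∀ f : SmoothFun n m' π', (hB.pullback f).jetDeriv θ w = 0) : w = 0 := by
  -- With `w' = 0` the coordinate formula says that the row vector `w` is annihilated by the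
  -- invertible matrix `(Dₛξⁱ)`.
  have h1 := coord_push_eq hc' hπ' hB (w := w) (w' := 0) fun f => by rw [h f, map_zero]
  have h2 : Matrix.vecMul (show Euc n from w).ofLp
      (Matrix.of fun s i : Fin n => totalDeriv s (xiComponent B (B θ).base i) θ) = 0 :=
    funext fun i => (h1 i).symm
  have h3 := Matrix.eq_zero_of_vecMul_eq_zero hreg h2
  exact PiLp.ext (p := 2) (x := (show Euc n from w)) (y := 0) fun i => congrFun h3 i

theorem IsIntegralManifold.comp [T2Space M] {d : ℕ} {N : Type*} [TopologicalSpace N]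
    [ChartedSpace (Euc d) N]
    (hc : ∀ e : E, ∃ c : FibredChart n m π, e ∈ c.total.source)
    (hπ : ContMDiff (𝓡 (n + m)) (𝓡 n) ∞ π)
    (hc' : ∀ e : E', ∃ c : FibredChart n m' π', e ∈ c.total.source)
    (hπ' : ContMDiff (𝓡 (n + m')) (𝓡 n) ∞ π')
    {B : JetInf n m π → JetInf n m' π'} (hB : IsCMorphism B)
    {ι : N → JetInf n m π} (hι : IsIntegralManifold d ι) (hind : IndependenceCondition d ι)
    (hreg : ∀ p : N, IsRegularAt B (ι p)) :
    IsIntegralManifold d (fun p => B (ι p)) ∧ IndependenceCondition d (fun p => B (ι p)) := by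
  obtain ⟨hsm, himm, hcart⟩ := hι
  have hsm' : ∀ f : SmoothFun n m' π', ContMDiff (𝓡 d) 𝓘(ℝ, ℝ) ∞ (fun q => f.1 (B (ι q))) :=
    fun f => hsm (hB.1.pullback f)
  have hcart' : ∀ (p : N) (X : TangentSpace (𝓡 d) p),
      pushTangent (fun q => B (ι q)) p X ∈ cartan (B (ι p)) := fun p X =>
    pushTangent_comp_mem_cartan hB (hcart p X)
  have hφ : ∀ q, MDifferentiableAt (𝓡 d) (𝓡 n) (fun q => (ι q).base) q := fun q =>
    ((base_comp_contMDiffOn hc hπ isOpen_univ fun f => (hsm f).contMDiffOn).contMDiffAt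
      Filter.univ_mem).mdifferentiableAt (by simp)
  have hφ' : ∀ q, MDifferentiableAt (𝓡 d) (𝓡 n) (fun q => (B (ι q)).base) q := fun q =>
    ((base_comp_contMDiffOn hc' hπ' isOpen_univ fun f => (hsm' f).contMDiffOn).contMDiffAt
      Filter.univ_mem).mdifferentiableAt (by simp)
  have htan := fun q (X : TangentSpace (𝓡 d) q) =>
    mfderiv_eq_jetDeriv_of_mem_cartan hc hπ (hφ q) (hcart q X)
  have htan' := fun q (X : TangentSpace (𝓡 d) q) =>
    mfderiv_eq_jetDeriv_of_mem_cartan hc' hπ' (hφ' q) (hcart' q X)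
  refine ⟨⟨hsm', fun p X hX => ?_, hcart'⟩, fun p => ?_⟩
  · refine himm p X (funext fun f => ?_)
    have h1 : mfderiv (𝓡 d) (𝓡 n) (fun q => (ι q).base) p X = 0 :=
      (hreg p).eq_zero_of_push_eq_zero hc' hπ' hB.1 fun f =>
        (htan p X (hB.1.pullback f)).symm.trans (congrFun hX f)
    refine (htan p X f).trans ?_
    rw [h1, map_zero]
    rfl
  · obtain ⟨v, hv⟩ := hind p
    refine ⟨v, ?_⟩
    -- The chain rule for `x' ∘ B ∘ ι`; the transpose appears because the rows of `(Dₛξⁱ)` are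
    -- indexed by `s`.
    have h1 : (Matrix.of fun i j : Fin n => (mfderiv (𝓡 d) 𝓘(ℝ, ℝ)
          (fun q => (chartAt (Euc n) (B (ι p)).base (B (ι q)).base) i) p (v j) : ℝ)) =
        (Matrix.of fun s i : Fin n =>
          totalDeriv s (xiComponent B (B (ι p)).base i) (ι p)).transpose *
        (Matrix.of fun i j : Fin n => (mfderiv (𝓡 d) 𝓘(ℝ, ℝ)
          (fun q => (chartAt (Euc n) (ι p).base (ι q).base) i) p (v j) : ℝ)) := by
      ext i j
      rw [Matrix.mul_apply]
      refine (mfderiv_coord_comp (hφ' p) i (v j)).trans ((coord_push_eq hc' hπ' hB.1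
        (w := mfderiv (𝓡 d) (𝓡 n) (fun q => (ι q).base) p (v j)) (fun f =>
          (htan p (v j) (hB.1.pullback f)).symm.trans (htan' p (v j) f)) i).trans
        (Finset.sum_congr rfl fun s _ => ?_))
      rw [mul_comm]
      exact congrArg (_ * ·) (mfderiv_coord_comp (hφ p) s (v j)).symm
    rw [h1, Matrix.det_mul, Matrix.det_transpose]
    exact mul_ne_zero (hreg p) hv

/-- A `𝓒`-morphism maps the prolongation of a local section to a prolongation, near every point
at which it is regular. -/
theorem LocalSection.isProlongationNear_comp [T2Space E'] [IsManifold (𝓡 (n + m')) ∞ E']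
    (hc' : ∀ e : E', ∃ c : FibredChart n m' π', e ∈ c.total.source)
    (hπ' : ContMDiff (𝓡 (n + m')) (𝓡 n) ∞ π')
    {B : JetInf n m π → JetInf n m' π'} (hB : IsCMorphism B) (s : LocalSection n m π) (a : s.dom)
    (hreg : IsRegularAt B (s.prolong a)) :
    IsProlongationNear (fun x : s.dom => B (s.prolong x)) a := by
  classical
  -- Extending the prolongation by a constant avoids a manifold structure on `s.dom`; only the
  -- values on this open set matter.
  let ι : M → JetInf n m π := fun x => if h : x ∈ s.dom then s.prolong ⟨x, h⟩ else s.prolong a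
  have hι : ∀ x (h : x ∈ s.dom), ι x = s.prolong ⟨x, h⟩ := fun x h => dif_pos h
  have hpull : ∀ (f : SmoothFun n m π) (x : M), x ∈ s.dom →
      (fun y => f.1 (ι y)) =ᶠ[𝓝 x] s.pullback f.1 := by
    intro f x hx
    filter_upwards [s.dom.isOpen.mem_nhds hx] with y hy
    have hy' : y ∈ s.dom := hy
    rw [LocalSection.pullback, dif_pos hy', hι y hy']
  have hsm : ∀ f : SmoothFun n m π, ContMDiffOn (𝓡 n) 𝓘(ℝ, ℝ) ∞ (fun q => f.1 (ι q)) s.dom :=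
    fun f x hx => ((s.pullback_contMDiffAt f hx).congr_of_eventuallyEq
      (hpull f x hx)).contMDiffWithinAt
  have hsm' : ∀ f : SmoothFun n m' π',
      ContMDiffOn (𝓡 n) 𝓘(ℝ, ℝ) ∞ (fun q => f.1 (B (ι q))) s.dom :=
    fun f => hsm (hB.1.pullback f)
  have hder : ∀ (f : SmoothFun n m π) (x : s.dom) (X : Euc n),
      mfderiv (𝓡 n) 𝓘(ℝ, ℝ) (fun q => f.1 (ι q)) x.1 X = f.jetDeriv (s.prolong x) X := by
    intro f x X
    rw [f.jetDeriv_prolong s x]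
    exact congrArg (fun L : Euc n →L[ℝ] ℝ => L X) (hpull f x.1 x.2).mfderiv_eq
  have hcart : ∀ x ∈ s.dom, ∀ X : TangentSpace (𝓡 n) x, pushTangent ι x X ∈ cartan (ι x) := by
    intro x hx X
    rw [hι x hx]
    exact mem_cartan_iff.2 ⟨X, funext fun f => hder f ⟨x, hx⟩ X⟩
  have hφ' : ∀ x ∈ s.dom, MDifferentiableAt (𝓡 n) (𝓡 n) (fun q => (B (ι q)).base) x :=
    fun x hx => ((base_comp_contMDiffOn hc' hπ' s.dom.isOpen hsm').contMDiffAt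
      (s.dom.isOpen.mem_nhds hx)).mdifferentiableAt (by simp)
  have htan' := fun (f : SmoothFun n m' π') x hx (X : TangentSpace (𝓡 n) x) =>
    mfderiv_eq_jetDeriv_of_mem_cartan hc' hπ' (hφ' x hx)
      (pushTangent_comp_mem_cartan hB (hcart x hx X)) f
  have hbij : Function.Bijective (mfderiv (𝓡 n) (𝓡 n) (fun q => (B (ι q)).base) a.1) := by
    have hinj : ∀ X, mfderiv (𝓡 n) (𝓡 n) (fun q => (B (ι q)).base) a.1 X = 0 → X = 0 := by
      intro X hX
      refine hreg.eq_zero_of_push_eq_zero hc' hπ' hB.1 (w := X) fun f => ?_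
      refine (hder (hB.1.pullback f) a X).symm.trans ((htan' f a.1 a.2 X).trans ?_)
      rw [hX, map_zero]
    let L : Euc n →ₗ[ℝ] Euc n :=
      (mfderiv (𝓡 n) (𝓡 n) (fun q => (B (ι q)).base) a.1).toLinearMap
    have hL : Function.Injective L := (injective_iff_map_eq_zero L).2 hinj
    -- Both bases have dimension `n`, so injectivity from regularity already gives bijectivity.
    have hL' : Function.Surjective L := LinearMap.injective_iff_surjective.1 hL
    exact ⟨hL, hL'⟩
  obtain ⟨U, hU, haU, hUW, t, hbijOn, ht⟩ :=
    isProlongationNear_of_bijective hc' hπ' s.dom.isOpen hsm' htan' a.2 hbij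
  have hval : ∀ x : s.dom, B (ι x.1) = B (s.prolong x) := fun x => congrArg B (hι x.1 x.2)
  refine ⟨Subtype.val ⁻¹' U, hU.preimage continuous_subtype_val, haU, t, ⟨?_, ?_, ?_⟩, ?_⟩
  · intro x hx
    change (B (s.prolong x)).base ∈ (t.dom : Set M')
    rw [← hval x]
    exact hbijOn.mapsTo hx
  · intro x hx y hy hxy
    refine Subtype.ext (hbijOn.injOn hx hy ?_)
    rw [hval x, hval y]
    exact hxy
  · intro z hz
    obtain ⟨x, hx, hxz⟩ := hbijOn.surjOn hz
    refine ⟨⟨x, hUW hx⟩, hx, ?_⟩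
    rw [← hxz]
    exact congrArg JetInf.base (hval ⟨x, hUW hx⟩).symm
  · intro x hx
    have h := ht x.1 hx
    rw [hval x] at h
    exact h

end Regular

end JetGeom

theorem mainTheorem7 (n m m' : ℕ)
    {M : Type*} [TopologicalSpace M] [T2Space M] [SecondCountableTopology M]
    [ChartedSpace (Euc n) M] [IsManifold (𝓡 n) ∞ M]
    {E : Type*} [TopologicalSpace E] [T2Space E] [SecondCountableTopology E]
    [ChartedSpace (Euc (n + m)) E] [IsManifold (𝓡 (n + m)) ∞ E]
    {F : Type*} [TopologicalSpace F] [ChartedSpace (Euc m) F] [IsManifold (𝓡 m) ∞ F]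
    (π : E → M) (hπ : IsSmoothFiberBundle n m F π)
    {M' : Type*} [TopologicalSpace M'] [T2Space M'] [SecondCountableTopology M']
    [ChartedSpace (Euc n) M'] [IsManifold (𝓡 n) ∞ M']
    {E' : Type*} [TopologicalSpace E'] [T2Space E'] [SecondCountableTopology E']
    [ChartedSpace (Euc (n + m')) E'] [IsManifold (𝓡 (n + m')) ∞ E']
    {F' : Type*} [TopologicalSpace F'] [ChartedSpace (Euc m') F'] [IsManifold (𝓡 m') ∞ F']
    (π' : E' → M') (hπ' : IsSmoothFiberBundle n m' F' π')
    (B : JetInf n m π → JetInf n m' π') (hB : IsCMorphism B) :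
    (∀ (d : ℕ) {N : Type*} [TopologicalSpace N] [ChartedSpace (Euc d) N] [IsManifold (𝓡 d) ∞ N]
        (ι : N → JetInf n m π), IsIntegralManifold d ι → IndependenceCondition d ι →
        (∀ p : N, IsRegularAt B (ι p)) →
        IsIntegralManifold d (fun p => B (ι p)) ∧ IndependenceCondition d (fun p => B (ι p)) ∧
          ∀ p : N, IsProlongationNear (fun q => B (ι q)) p) ∧
    (∀ (s : LocalSection n m π) (a : s.dom), IsRegularAt B (s.prolong a) →
        IsProlongationNear (fun x : s.dom => B (s.prolong x)) a) := by
  have hc := fun e : E => hπ.exists_fibredChart e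
  have hc' := fun e : E' => hπ'.exists_fibredChart e
  refine ⟨fun d N _ _ _ ι hι hind hreg => ?_, fun s a hreg =>
    s.isProlongationNear_comp hc' hπ'.contMDiff hB a hreg⟩
  obtain ⟨h1, h2⟩ := hι.comp hc hπ.contMDiff hc' hπ'.contMDiff hB hind hreg
  exact ⟨h1, h2, h1.isProlongationNear hc' hπ'.contMDiff h2⟩
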